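/- Let $A\in\mathbb R^{n\times n}$, $B\in\mathbb R^{n\times m}$, $C_p\in\mathbb R^{p\times n}$, $D_p\in\mathbb R^{p\times m}$, $C_r\in\mathbb R^{r\times n}$, $D_r\in\mathbb R^{r\times m}$, and consider $\dot x=Ax+Bu$ with outputs $y_p=C_px+D_pu$, $y_r=C_rx+D_ru$. For $\epsilon>0$ define the regularized cyclic output-to-output gain (RCOOG) $$\|\Sigma\|_{y_p\overset{\epsilon}{\hookleftarrow}y_r}=\sup\Big\{\int_0^\infty\|y_p\|_2^2\,dt \;:\; u\in\mathscr L_{2e},\ x(0)=0,\ \lim_{t\to\infty}x(t)=0,\ \int_0^\infty\|y_r\|_2^2\,dt+\epsilon\int_0^\infty\|u\|_2^2\,dt\le 1\Big\}\in[0,\infty],$$ where $\mathscr L_{2e}$ is the set of signals that are square integrable on $[0,T]$ for every $T<\infty$. For $\gamma>0$ put $\mathcal D=\gamma D_r^TD_r+\gamma\epsilon I-D_p^TD_p$ and, if $\mathcal D$ is invertible, $K=\mathcal D^{-1}(D_p^TC_p-\gamma D_r^TC_r)$ and $$M_\gamma=\begin{bmatrix}A+BK&-B\mathcal D^{-1}B^T\\-\gamma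 C_r^T(C_r+D_rK)+C_p^T(C_p+D_pK)&-(A+BK)^T\end{bmatrix}.$$ Write $G_p(s)=C_p(sI-A)^{-1}B+D_p$, $G_r(s)=C_r(sI-A)^{-1}B+D_r$. The generalized singular values of a pair $(M,N)$ are the $\sigma>0$ with $M^HMv=\sigma^2N^HNv$ for some $v\ne0$. Assume that $A$ is stable (all its eigenvalues have negative real part), $\epsilon>0$, $\gamma>0$, and $\mathcal D$ is invertible. (i) If $\|\Sigma\|_{y_p\overset{\epsilon}{\hookleftarrow}y_r}<\gamma$, then $M_\gamma$ has no purely imaginary eigenvalue $i\omega$, $\omega\in\mathbb R$ (zero included). (ii) Suppose that at some frequency $\omega_0\in\mathbb R$ every generalized singular value $\sigma$ of $\Big(G_p(i\omega_0),\left(\begin{smallmatrix}G_r(i\omega_0)\\ \sqrt\epsilon I\end{smallmatrix}\right)\Big)$ satisfies $\sigma^2<\gamma$. Then $\|\Sigma\|_{y_p\overset{\epsilon}{\hookleftarrow}y_r}<\gamma$ if and only if $M_\gamma$ has no purely imaginary eigenvalue. -/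

import Mathlib

open MeasureTheory Filter Topology
open scoped Matrix ENNReal

noncomputable section

/-- Data of a linear system `ẋ = A x + B u` with the two outputs
`y_p = C_p x + D_p u` and `y_r = C_r x + D_r u`. -/
structure TwoOutputSystem (n m p r : ℕ) where
  A : Matrix (Fin n) (Fin n) ℝ
  B : Matrix (Fin n) (Fin m) ℝ
  Cp : Matrix (Fin p) (Fin n) ℝ
  Dp : Matrix (Fin p) (Fin m) ℝ
  Cr : Matrix (Fin r) (Fin n) ℝ
  Dr : Matrix (Fin r) (Fin m) ℝ

/-- Entrywise inclusion of real matrices into complex matrices. -/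
abbrev toComplexMatrix {k l : Type*} (M : Matrix k l ℝ) : Matrix k l ℂ :=
  M.map Complex.ofReal

/-- A real square matrix is stable (Hurwitz) if all its complex eigenvalues have negative
real part. -/
def IsHurwitz {n : ℕ} (A : Matrix (Fin n) (Fin n) ℝ) : Prop :=
  ∀ μ : ℂ, Module.End.HasEigenvalue (Matrix.toLin' (toComplexMatrix A)) μ → μ.re < 0

/-- `M` has an eigenvalue on the imaginary axis (zero included). -/
def HasImaginaryEigenvalue {k : Type*} [Fintype k] [DecidableEq k] (M : Matrix k k ℝ) : Prop :=
  ∃ ω : ℝ, Module.End.HasEigenvalue (Matrix.toLin' (toComplexMatrix M)) (Complex.I * ω)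

/-- Generalized singular values of a pair of complex matrices with the same number of columns. -/
def genSingularValues {k l q : Type*} [Fintype k] [Fintype l] [Fintype q]
    (M : Matrix k l ℂ) (N : Matrix q l ℂ) : Set ℝ :=
  {σ : ℝ | 0 < σ ∧ ∃ v : l → ℂ, v ≠ 0 ∧
    (Mᴴ * M) *ᵥ v = ((σ : ℂ) ^ 2) • ((Nᴴ * N) *ᵥ v)}

/-- The transfer function `C (s I - A)⁻¹ B + D`. -/
def transferFunction {n m q : ℕ} (A : Matrix (Fin n) (Fin n) ℝ) (B : Matrix (Fin n) (Fin m) ℝ)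
    (C : Matrix (Fin q) (Fin n) ℝ) (D : Matrix (Fin q) (Fin m) ℝ) (s : ℂ) :
    Matrix (Fin q) (Fin m) ℂ :=
  toComplexMatrix C * (s • (1 : Matrix (Fin n) (Fin n) ℂ) - toComplexMatrix A)⁻¹
    * toComplexMatrix B + toComplexMatrix D

/-- The extended `L₂` space of signals on `[0, ∞)`: square integrable on every `[0, T]`. -/
def MemL2e {m : ℕ} (u : ℝ → EuclideanSpace ℝ (Fin m)) : Prop :=
  ∀ T : ℝ, MemLp u 2 (volume.restrict (Set.Icc 0 T))

/-- The squared `L₂` norm `∫₀^∞ ‖y(t)‖² dt`, with values in `[0, ∞]`. -/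
def energy {q : ℕ} (y : ℝ → EuclideanSpace ℝ (Fin q)) : ℝ≥0∞ :=
  ∫⁻ t in Set.Ici (0 : ℝ), ‖y t‖ₑ ^ 2

/-- The signal `t ↦ C x(t) + D u(t)`. -/
def outputSignal {n m q : ℕ} (C : Matrix (Fin q) (Fin n) ℝ) (D : Matrix (Fin q) (Fin m) ℝ)
    (x : ℝ → EuclideanSpace ℝ (Fin n)) (u : ℝ → EuclideanSpace ℝ (Fin m)) :
    ℝ → EuclideanSpace ℝ (Fin q) :=
  fun t => WithLp.toLp 2 (C *ᵥ (x t).ofLp + D *ᵥ (u t).ofLp)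

namespace TwoOutputSystem

variable {n m p r : ℕ}

/-- `G_p(s)`. -/
def Gp (S : TwoOutputSystem n m p r) (s : ℂ) : Matrix (Fin p) (Fin m) ℂ :=
  transferFunction S.A S.B S.Cp S.Dp s

/-- `G_r(s)`. -/
def Gr (S : TwoOutputSystem n m p r) (s : ℂ) : Matrix (Fin r) (Fin m) ℂ :=
  transferFunction S.A S.B S.Cr S.Dr s

/-- `G_r(s)` stacked on top of `√ε I`. -/
def GrReg (S : TwoOutputSystem n m p r) (ε : ℝ) (s : ℂ) : Matrix (Fin r ⊕ Fin m) (Fin m) ℂ :=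
  Matrix.fromRows (S.Gr s) ((Real.sqrt ε : ℂ) • (1 : Matrix (Fin m) (Fin m) ℂ))

/-- `x` is the state trajectory on `[0, ∞)` for the input `u`, started at `x(0) = 0`: the
(Carathéodory) solution of `ẋ = A x + B u`, written as an integral equation. -/
def IsTrajectoryFromZero (S : TwoOutputSystem n m p r)
    (u : ℝ → EuclideanSpace ℝ (Fin m)) (x : ℝ → EuclideanSpace ℝ (Fin n)) : Prop :=
  ContinuousOn x (Set.Ici 0) ∧
    ∀ t : ℝ, 0 ≤ t → x t = ∫ τ in (0 : ℝ)..t, outputSignal S.A S.B x u τ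

/-- Feasibility for the optimization problem defining the regularized cyclic
output-to-output gain. -/
def IsFeasible (S : TwoOutputSystem n m p r) (ε : ℝ)
    (u : ℝ → EuclideanSpace ℝ (Fin m)) (x : ℝ → EuclideanSpace ℝ (Fin n)) : Prop :=
  MemL2e u ∧ S.IsTrajectoryFromZero u x ∧ Tendsto x atTop (𝓝 0) ∧
    energy (outputSignal S.Cr S.Dr x u) + ENNReal.ofReal ε * energy u ≤ 1

/-- The regularized cyclic output-to-output gain, with values in `[0, ∞]`. -/
def rcoog (S : TwoOutputSystem n m p r) (ε : ℝ) : ℝ≥0∞ :=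
  ⨆ (u : ℝ → EuclideanSpace ℝ (Fin m)) (x : ℝ → EuclideanSpace ℝ (Fin n))
    (_ : S.IsFeasible ε u x), energy (outputSignal S.Cp S.Dp x u)

/-- `𝒟 = γ D_rᵀ D_r + γ ε I - D_pᵀ D_p`. -/
def calD (S : TwoOutputSystem n m p r) (ε γ : ℝ) : Matrix (Fin m) (Fin m) ℝ :=
  γ • (S.Drᵀ * S.Dr) + (γ * ε) • (1 : Matrix (Fin m) (Fin m) ℝ) - S.Dpᵀ * S.Dp

/-- `K = 𝒟⁻¹ (D_pᵀ C_p - γ D_rᵀ C_r)`. -/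
def gainK (S : TwoOutputSystem n m p r) (ε γ : ℝ) : Matrix (Fin m) (Fin n) ℝ :=
  (S.calD ε γ)⁻¹ * (S.Dpᵀ * S.Cp - γ • (S.Drᵀ * S.Cr))

/-- The Hamiltonian matrix `M_γ`. -/
def hamiltonian (S : TwoOutputSystem n m p r) (ε γ : ℝ) :
    Matrix (Fin n ⊕ Fin n) (Fin n ⊕ Fin n) ℝ :=
  Matrix.fromBlocks
    (S.A + S.B * S.gainK ε γ)
    (-(S.B * (S.calD ε γ)⁻¹ * S.Bᵀ))
    (-(γ • (S.Crᵀ * (S.Cr + S.Dr * S.gainK ε γ))) + S.Cpᵀ * (S.Cp + S.Dp * S.gainK ε γ))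
    (-(S.A + S.B * S.gainK ε γ)ᵀ)

end TwoOutputSystem

end

/-! Two equivalences meet in the frequency domain. Write the Popov matrix at `ω` as `Φ(ω) = γ (G_rᴴ
G_r + ε I) - G_pᴴ G_p`, evaluated at `iω`. Its quadratic form compares the energies of the three
signals for a sinusoidal input.

Algebra (`hasEigenvalue_hamiltonian_iff`): the state, costate and input equations of the associated
optimal control problem can be reduced in two ways. Eliminating the input through `𝒟⁻¹` gives the
eigenvector equation of `M_γ`; eliminating state and costate through the resolvents gives `Φ(ω) u =
0`. Hence `iω` is an eigenvalue of `M_γ` exactly when `Φ(ω)` is singular.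

Analysis: for `g > 0`, gain at most `g` is equivalent to `‖G_p v‖² ≤ g (‖G_r v‖² + ε ‖v‖²)` at every
frequency. From frequency to time (`lintegral_output_le_of_frequency`), the input is cut off at `T`
and the state continues freely. No jump appears at `T`, so Plancherel applies, and the added tail
energy is at most a constant times `‖x(T)‖²`, which tends to zero. From time to frequency
(`frequency_of_energy`), damped exponentials of rate `δ` are used as inputs: their energy grows like
`1/δ` while the transients stay bounded, and `δ → 0` isolates the frequency response.

For (i), a gain below `γ` is at most some `g < γ`, and the inequality with `g` excludes null vectors
of `Φ`. For (ii), the frequency axis is compactified by a point at infinity, where `Φ = 𝒟`. A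
continuous Hermitian family, nonsingular on a compact connected space and positive definite at `ω₀`,
is positive definite everywhere, with a uniform margin (`exists_uniform_gain_lt`); the margin gives
a gain strictly below `γ`. -/

noncomputable section

/-! ### Exponential decay of the flow of a stable operator. -/

section ExponentialDecay

variable {X : Type*} [NormedAddCommGroup X] [NormedSpace ℂ X]

/-- The flow `t ↦ exp (t A)` of a bounded operator, at real times. -/
def expFlow (A : X →L[ℂ] X) (t : ℝ) : X →L[ℂ] X := NormedSpace.exp ((t : ℂ) • A)

@[simp] lemma expFlow_zero (A : X →L[ℂ] X) : expFlow A 0 = 1 := by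
  simp [expFlow]

variable [CompleteSpace X]

lemma hasDerivAt_expFlow (A : X →L[ℂ] X) (v : X) (t : ℝ) :
    HasDerivAt (fun t => expFlow A t v) (A (expFlow A t v)) t := by
  have h := (hasDerivAt_exp_smul_const' A (t : ℂ)).scomp t (Complex.ofRealCLM.hasDerivAt (x := t))
  rw [Complex.ofRealCLM_apply, Complex.ofReal_one, one_smul] at h
  exact ((ContinuousLinearMap.apply ℂ X v).restrictScalars ℝ).hasFDerivAt.comp_hasDerivAt t h

lemma hasDerivAt_expFlow' (A : X →L[ℂ] X) (v : X) (t : ℝ) :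
    HasDerivAt (fun t => expFlow A t v) (expFlow A t (A v)) t := by
  have h := (hasDerivAt_exp_smul_const A (t : ℂ)).scomp t (Complex.ofRealCLM.hasDerivAt (x := t))
  rw [Complex.ofRealCLM_apply, Complex.ofReal_one, one_smul] at h
  exact ((ContinuousLinearMap.apply ℂ X v).restrictScalars ℝ).hasFDerivAt.comp_hasDerivAt t h

lemma continuous_expFlow_apply (A : X →L[ℂ] X) (v : X) : Continuous fun t => expFlow A t v :=
  continuous_iff_continuousAt.2 fun t => (hasDerivAt_expFlow A v t).continuousAt

/-- The derivative of `e^{-μs} e^{sA} v` is `e^{-μs} e^{sA} (A v - μ v)`, of norm at most `C e^{bs}`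
with `b = -Re μ - a`. Since `b > 0`, integration costs only the factor `1/b`, so passing from `A v -
μ v` to `v` keeps the rate `a` and produces no polynomial factor. -/
lemma exists_norm_expFlow_le_of_sub (A : X →L[ℂ] X) {μ : ℂ} {a : ℝ} (hμ : μ.re < -a) {v : X}
    (h : ∃ C, ∀ t, 0 ≤ t → ‖expFlow A t (A v - μ • v)‖ ≤ C * Real.exp (-a * t)) :
    ∃ C, ∀ t, 0 ≤ t → ‖expFlow A t v‖ ≤ C * Real.exp (-a * t) := by
  obtain ⟨C, hC⟩ := h
  set b : ℝ := -μ.re - a with hb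
  have hb0 : 0 < b := by simp only [hb]; linarith
  have hC0 : 0 ≤ C := by simpa using (norm_nonneg _).trans (hC 0 le_rfl)
  have hexp : ∀ t : ℝ, ‖Complex.exp (-μ * t)‖ = Real.exp (-μ.re * t) := fun t => by
    rw [Complex.norm_exp]; simp
  refine ⟨‖v‖ + C / b, fun t ht => ?_⟩
  have hderiv : ∀ s : ℝ, HasDerivAt (fun s : ℝ => Complex.exp (-μ * s) • expFlow A s v)
      (Complex.exp (-μ * s) • expFlow A s (A v - μ • v)) s := fun s => by
    have h1 : HasDerivAt (fun s : ℝ => Complex.exp (-μ * s)) (Complex.exp (-μ * s) * (-μ)) s := by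
      have := ((Complex.ofRealCLM.hasDerivAt (x := s)).const_mul (-μ)).cexp
      simpa using this
    convert! h1.smul (hasDerivAt_expFlow' A v s) using 1
    simp [mul_smul, sub_eq_add_neg]
  have hB : ∀ s : ℝ, HasDerivAt (fun s : ℝ => ‖v‖ + C / b * (Real.exp (b * s) - 1))
      (C * Real.exp (b * s)) s := fun s => by
    have := ((((hasDerivAt_id s).const_mul b).exp.sub_const 1).const_mul (C / b)).const_add ‖v‖
    convert! this using 1
    simp; field_simp
  have key := image_norm_le_of_norm_deriv_right_le_deriv_boundary
    (f := fun s : ℝ => Complex.exp (-μ * s) • expFlow A s v) (a := 0) (b := t)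
    (fun s _ => (hderiv s).continuousAt.continuousWithinAt)
    (fun s _ => (hderiv s).hasDerivWithinAt) (by simp) hB
    (fun s hs => by
      rw [norm_smul, hexp]
      calc _ ≤ Real.exp (-μ.re * s) * (C * Real.exp (-a * s)) := by gcongr; exact hC s hs.1
        _ = C * (Real.exp (-μ.re * s) * Real.exp (-a * s)) := by ring
        _ ≤ _ := by rw [← Real.exp_add]; apply le_of_eq; congr 2; simp only [hb]; ring)
    (x := t) ⟨ht, le_rfl⟩
  rw [norm_smul, hexp] at key
  have h1 : ‖v‖ + C / b * (Real.exp (b * t) - 1) ≤ (‖v‖ + C / b) * Real.exp (b * t) := by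
    have : 1 ≤ Real.exp (b * t) := Real.one_le_exp (by positivity)
    have h2 : 0 ≤ C / b := by positivity
    nlinarith [norm_nonneg v]
  have h3 : Real.exp (-μ.re * t) * ‖expFlow A t v‖ ≤
      Real.exp (-μ.re * t) * ((‖v‖ + C / b) * Real.exp (-a * t)) := by
    refine key.trans (h1.trans (le_of_eq ?_))
    rw [mul_left_comm, ← Real.exp_add]
    congr 2; simp only [hb]; ring
  exact le_of_mul_le_mul_left h3 (Real.exp_pos _)

/-- Over `ℂ` the generalized eigenspaces span the space. On each of them, induction on the order of
the generalized eigenvector applies, because `A - μ` lowers that order. -/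
lemma exists_norm_expFlow_apply_le [FiniteDimensional ℂ X] (A : X →L[ℂ] X) {a : ℝ}
    (hA : ∀ μ : ℂ, Module.End.HasEigenvalue (A : X →ₗ[ℂ] X) μ → μ.re < -a) (v : X) :
    ∃ C, ∀ t, 0 ≤ t → ‖expFlow A t v‖ ≤ C * Real.exp (-a * t) := by
  have hv : v ∈ ⨆ μ, Module.End.maxGenEigenspace (A : X →ₗ[ℂ] X) μ := by
    rw [Module.End.iSup_maxGenEigenspace_eq_top]; trivial
  refine Submodule.iSup_induction _ (motive := fun v => ∃ C, ∀ t, 0 ≤ t →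
    ‖expFlow A t v‖ ≤ C * Real.exp (-a * t)) hv ?_ ⟨0, by simp⟩ ?_
  · intro μ w hw
    rw [Module.End.mem_maxGenEigenspace] at hw
    obtain ⟨k, hk⟩ := hw
    induction k generalizing w with
    | zero => exact ⟨0, by simp_all⟩
    | succ k ih =>
      by_cases hw0 : w = 0
      · exact ⟨0, by simp [hw0]⟩
      refine exists_norm_expFlow_le_of_sub A (hA μ ?_) (ih (A w - μ • w) ?_)
      · apply Module.End.hasEigenvalue_of_hasGenEigenvalue (k := k + 1)
        rw [Module.End.hasGenEigenvalue_iff, Submodule.ne_bot_iff]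
        exact ⟨w, by rw [Module.End.mem_genEigenspace_nat]; exact hk, hw0⟩
      · rw [pow_succ] at hk
        simpa using hk
  · rintro x y ⟨C, hC⟩ ⟨C', hC'⟩
    refine ⟨C + C', fun t ht => ?_⟩
    rw [map_add, add_mul]
    exact (norm_add_le _ _).trans (add_le_add (hC t ht) (hC' t ht))

/-- The flow of an operator whose eigenvalues lie in the open left half plane decays
exponentially. -/
theorem exists_norm_expFlow_le [FiniteDimensional ℂ X] (A : X →L[ℂ] X)
    (hA : ∀ μ : ℂ, Module.End.HasEigenvalue (A : X →ₗ[ℂ] X) μ → μ.re < 0) :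
    ∃ C a : ℝ, 0 ≤ C ∧ 0 < a ∧ ∀ t, 0 ≤ t → ‖expFlow A t‖ ≤ C * Real.exp (-a * t) := by
  -- There are finitely many eigenvalues, so one rate `a > 0` serves them all.
  obtain ⟨a, ha0, ha⟩ : ∃ a : ℝ, 0 < a ∧
      ∀ μ ∈ {μ | Module.End.HasEigenvalue (A : X →ₗ[ℂ] X) μ}, μ.re < -a := by
    have h1 : ∀ᶠ a : ℝ in 𝓝[>] 0, ∀ μ ∈ {μ | Module.End.HasEigenvalue (A : X →ₗ[ℂ] X) μ},
        μ.re < -a := by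
      rw [Filter.eventually_all_finite (Module.End.finite_hasEigenvalue _)]
      intro μ hμ
      have : Tendsto (fun a : ℝ => -a) (𝓝[>] 0) (𝓝 0) := by
        have : Continuous fun a : ℝ => -a := continuous_neg
        simpa using (this.tendsto 0).mono_left nhdsWithin_le_nhds
      exact this.eventually_const_lt (hA μ hμ)
    obtain ⟨a, h, h'⟩ := (h1.and self_mem_nhdsWithin).exists
    exact ⟨a, h', h⟩
  -- Uniform boundedness turns the constants depending on `v` into an operator norm bound.
  obtain ⟨C, hC⟩ := banach_steinhaus
    (g := fun t : Set.Ici (0 : ℝ) => ((Real.exp (a * t) : ℝ) : ℂ) • expFlow A t) (fun v => by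
      obtain ⟨C, hC⟩ := exists_norm_expFlow_apply_le A ha v
      refine ⟨C, fun t => ?_⟩
      rw [smul_apply, norm_smul, Complex.norm_real, Real.norm_eq_abs,
        Real.abs_exp]
      calc _ ≤ Real.exp (a * t) * (C * Real.exp (-a * t)) := by gcongr; exact hC _ t.2
        _ = C * (Real.exp (a * t) * Real.exp (-a * t)) := by ring
        _ = C := by rw [← Real.exp_add]; simp)
  refine ⟨C, a, (norm_nonneg _).trans (hC ⟨0, Set.self_mem_Ici⟩), ha0, fun t ht => ?_⟩
  have := hC ⟨t, ht⟩
  rw [norm_smul, Complex.norm_real, Real.norm_eq_abs, Real.abs_exp] at this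
  rw [neg_mul, Real.exp_neg, ← div_eq_mul_inv, le_div_iff₀ (Real.exp_pos _), mul_comm]
  exact this

end ExponentialDecay

/-! ### Plancherel's theorem for the Fourier integral on `L¹ ∩ L²`. -/

section Plancherel

open FourierTransform

variable {F : Type*} [NormedAddCommGroup F] [InnerProductSpace ℂ F] [CompleteSpace F]

/-- On `L¹ ∩ L²` the `L²` Fourier transform is given by the Fourier integral. -/
theorem coeFn_fourier_toLp_ae_eq {f : ℝ → F} (h1 : Integrable f) (h2 : MemLp f 2) :
    (𝓕 (h2.toLp f) : Lp F 2 (volume : Measure ℝ)) =ᵐ[volume] 𝓕 f := by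
  have hcont : Continuous (𝓕 f) :=
    VectorFourier.fourierIntegral_continuous Real.continuous_fourierChar
      (by exact continuous_inner) h1
  set g : Lp F 2 (volume : Measure ℝ) := 𝓕 (h2.toLp f) with hg
  have hgl : LocallyIntegrable g := (Lp.memLp g).locallyIntegrable (by norm_num)
  -- Both transforms are tested against smooth compactly supported `φ`. In each case the transform
  -- moves onto `φ`: for `g` through tempered distributions, for the integral through
  -- self-adjointness of the Fourier integral.
  have key : ∀ᵐ x, g x - 𝓕 f x = 0 := by
    apply ae_eq_zero_of_integral_contDiff_smul_eq_zero (hgl.sub hcont.locallyIntegrable)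
    intro φ hφ hφc
    have hφ₁ : HasCompactSupport (Complex.ofRealCLM ∘ φ) := hφc.comp_left rfl
    have hφ₂ : ContDiff ℝ ((⊤ : ℕ∞) : WithTop ℕ∞) (Complex.ofRealCLM ∘ φ) := by fun_prop
    set Φ := hφ₁.toSchwartzMap hφ₂
    have e1 : ∫ x, φ x • g x = ∫ x, (𝓕 Φ) x • f x := by
      have h := congrArg (fun T => T Φ) (Lp.fourier_toTemperedDistribution_eq (h2.toLp f))
      simp only [TemperedDistribution.fourier_apply, Lp.toTemperedDistribution_apply] at h
      rw [← hg] at h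
      calc _ = ∫ x, Φ x • g x := by simp [Φ]
        _ = _ := h.symm
        _ = _ := integral_congr_ae (by
          filter_upwards [h2.coeFn_toLp] with x hx
          rw [hx])
    have e2 : ∫ x, φ x • 𝓕 f x = ∫ x, (𝓕 Φ) x • f x := by
      have h := VectorFourier.integral_fourierIntegral_smul_eq_flip (L := innerₗ ℝ)
        Real.continuous_fourierChar (by exact continuous_inner) (Φ.integrable (μ := volume)) h1
      rw [flip_innerₗ] at h
      calc _ = ∫ x, Φ x • 𝓕 f x := by simp [Φ]
        _ = _ := h.symm
        _ = _ := by rw [SchwartzMap.fourier_coe]; rfl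
    have i1 : Integrable fun x => φ x • g x :=
      hgl.integrable_smul_left_of_hasCompactSupport hφ.continuous hφc
    have i2 : Integrable fun x => φ x • 𝓕 f x :=
      hcont.locallyIntegrable.integrable_smul_left_of_hasCompactSupport hφ.continuous hφc
    simp only [Pi.sub_apply, smul_sub]
    rw [integral_sub i1 i2, e1, e2, sub_self]
  filter_upwards [key] with x hx
  exact sub_eq_zero.1 hx

lemma eLpNorm_two_sq {α : Type*} [MeasurableSpace α] {E : Type*} [NormedAddCommGroup E]
    (f : α → E) (μ : Measure α) : eLpNorm f 2 μ ^ 2 = ∫⁻ x, ‖f x‖ₑ ^ 2 ∂μ := by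
  have := eLpNorm_nnreal_pow_eq_lintegral (μ := μ) (f := f) (p := 2) (by norm_num)
  simpa using this

/-- Plancherel's theorem on `L¹ ∩ L²`. -/
theorem lintegral_enorm_sq_fourier {f : ℝ → F} (h1 : Integrable f) (h2 : MemLp f 2) :
    ∫⁻ ξ, ‖𝓕 f ξ‖ₑ ^ 2 = ∫⁻ t, ‖f t‖ₑ ^ 2 := by
  rw [← eLpNorm_two_sq, ← eLpNorm_two_sq, ← eLpNorm_congr_ae (coeFn_fourier_toLp_ae_eq h1 h2),
    ← eLpNorm_congr_ae h2.coeFn_toLp, ← Lp.enorm_def, ← Lp.enorm_def, ← ofReal_norm, ← ofReal_norm,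
    Lp.norm_fourier_eq]

end Plancherel

/-! ### Laplace transforms of primitives and of the free flow. -/

section Laplace

variable {X : Type*} [NormedAddCommGroup X] [NormedSpace ℂ X]

lemma mul_intervalIntegral_exp_neg (s : ℂ) (a b : ℝ) :
    s * ∫ t in a..b, Complex.exp (-s * t) = Complex.exp (-s * a) - Complex.exp (-s * b) := by
  have h : ∀ t : ℝ, HasDerivAt (fun t : ℝ => -Complex.exp (-s * t))
      (s * Complex.exp (-s * t)) t := fun t => by
    have := ((Complex.ofRealCLM.hasDerivAt (x := t)).const_mul (-s)).cexp.neg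
    convert! this using 1
    simp [mul_comm]
  rw [← intervalIntegral.integral_const_mul,
    intervalIntegral.integral_eq_sub_of_hasDerivAt (fun t _ => h t)
      (Continuous.intervalIntegrable (by fun_prop) _ _)]
  ring

/-- Integration by parts for the truncated Laplace transform of an indefinite integral. -/
lemma smul_setIntegral_exp_smul_primitive [CompleteSpace X] (s : ℂ) {T : ℝ} (hT : 0 ≤ T) {g : ℝ → X}
    (hg : IntegrableOn g (Set.Ioc 0 T)) {x : ℝ → X}
    (hx : ∀ t ∈ Set.Icc 0 T, x t = ∫ τ in (0 : ℝ)..t, g τ) :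
    s • ∫ t in Set.Ioc 0 T, Complex.exp (-s * t) • x t =
      (∫ t in Set.Ioc 0 T, Complex.exp (-s * t) • g t) - Complex.exp (-s * T) • x T := by
  set μ : Measure ℝ := volume.restrict (Set.Ioc 0 T) with hμ
  have he : Integrable (fun t : ℝ => Complex.exp (-s * t)) μ := by
    have : Continuous fun t : ℝ => Complex.exp (-s * t) := by fun_prop
    exact (this.integrableOn_Icc (a := 0) (b := T)).mono_set Set.Ioc_subset_Icc_self
  have hset : MeasurableSet {p : ℝ × ℝ | p.2 ≤ p.1} :=
    measurableSet_le measurable_snd measurable_fst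
  have hF : Integrable (Set.indicator {p : ℝ × ℝ | p.2 ≤ p.1}
      (fun p : ℝ × ℝ => Complex.exp (-s * p.1) • g p.2)) (μ.prod μ) :=
    (he.smul_prod hg).indicator hset
  -- As `g` is merely integrable, classical integration by parts is replaced by Fubini on the
  -- triangle `τ ≤ t`. The inner integral over `t` is then that of an exponential.
  have swap := integral_integral_swap
    (f := fun t τ => Set.indicator {p : ℝ × ℝ | p.2 ≤ p.1}
      (fun p : ℝ × ℝ => Complex.exp (-s * p.1) • g p.2) (t, τ)) hF
  have e1 : ∫ t, (∫ τ, Set.indicator {p : ℝ × ℝ | p.2 ≤ p.1}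
      (fun p : ℝ × ℝ => Complex.exp (-s * p.1) • g p.2) (t, τ) ∂μ) ∂μ =
      ∫ t, Complex.exp (-s * t) • x t ∂μ := by
    refine setIntegral_congr_fun measurableSet_Ioc fun t ht => ?_
    have : (fun τ => Set.indicator {p : ℝ × ℝ | p.2 ≤ p.1}
        (fun p : ℝ × ℝ => Complex.exp (-s * p.1) • g p.2) (t, τ)) =
        Set.indicator (Set.Iic t) (fun τ => Complex.exp (-s * t) • g τ) := by
      ext τ; simp [Set.indicator]
    simp only [this]
    rw [integral_indicator measurableSet_Iic, hμ, Measure.restrict_restrict measurableSet_Iic,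
      hx t ⟨ht.1.le, ht.2⟩, intervalIntegral.integral_of_le ht.1.le, integral_smul]
    congr 3
    ext τ
    simp only [Set.mem_inter_iff, Set.mem_Iic, Set.mem_Ioc]
    exact ⟨fun h => ⟨h.2.1, h.1⟩, fun h => ⟨h.2, h.1, h.2.trans ht.2⟩⟩
  have e2 : ∀ τ ∈ Set.Ioc 0 T, s • (∫ t, Set.indicator {p : ℝ × ℝ | p.2 ≤ p.1}
      (fun p : ℝ × ℝ => Complex.exp (-s * p.1) • g p.2) (t, τ) ∂μ) =
      Complex.exp (-s * τ) • g τ - Complex.exp (-s * T) • g τ := by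
    intro τ hτ
    have : (fun t => Set.indicator {p : ℝ × ℝ | p.2 ≤ p.1}
        (fun p : ℝ × ℝ => Complex.exp (-s * p.1) • g p.2) (t, τ)) =
        Set.indicator (Set.Ici τ) (fun t : ℝ => Complex.exp (-s * t) • g τ) := by
      ext t; simp [Set.indicator]
    simp only [this]
    rw [integral_indicator measurableSet_Ici, hμ, Measure.restrict_restrict measurableSet_Ici]
    have h3 : Set.Ici τ ∩ Set.Ioc 0 T = Set.Icc τ T := by
      ext t
      simp only [Set.mem_inter_iff, Set.mem_Ici, Set.mem_Ioc, Set.mem_Icc]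
      exact ⟨fun h => ⟨h.1, h.2.2⟩, fun h => ⟨h.1, hτ.1.trans_le h.1, h.2⟩⟩
    rw [h3, integral_Icc_eq_integral_Ioc, integral_smul_const,
      ← intervalIntegral.integral_of_le hτ.2, smul_smul, mul_intervalIntegral_exp_neg, sub_smul]
  have heg : Integrable (fun t : ℝ => Complex.exp (-s * t) • g t) μ := by
    refine (IntegrableOn.continuousOn_smul (K := Set.Icc 0 T) ?_
      (by fun_prop : Continuous fun t : ℝ => Complex.exp (-s * t)).continuousOn
      isCompact_Icc).mono_set Set.Ioc_subset_Icc_self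
    rwa [integrableOn_Icc_iff_integrableOn_Ioc]
  have hgT : Integrable (fun t : ℝ => Complex.exp (-s * T) • g t) μ := hg.smul _
  rw [← e1, swap, ← integral_smul, setIntegral_congr_fun measurableSet_Ioc e2,
    integral_sub heg hgT, integral_smul, hx T ⟨hT, le_rfl⟩,
    intervalIntegral.integral_of_le hT]

lemma integrableOn_exp_neg_mul_sub {a : ℝ} (ha : 0 < a) (T : ℝ) :
    IntegrableOn (fun t => Real.exp (-a * (t - T))) (Set.Ioi T) := by
  have h := (integrableOn_exp_mul_Ioi (a := -a) (by linarith) T).const_mul (Real.exp (a * T))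
  refine h.congr (ae_of_all _ fun t => ?_)
  simp only
  rw [← Real.exp_add]; congr 1; ring

lemma integral_exp_neg_mul_sub {a : ℝ} (ha : 0 < a) (T : ℝ) :
    ∫ t in Set.Ioi T, Real.exp (-a * (t - T)) = 1 / a := by
  have h : ∀ t, Real.exp (-a * (t - T)) = Real.exp (a * T) * Real.exp (-a * t) := fun t => by
    rw [← Real.exp_add]; congr 1; ring
  simp_rw [h]
  rw [integral_const_mul, integral_exp_mul_Ioi (by linarith), mul_div_assoc', mul_neg,
    ← Real.exp_add]
  simp

lemma tendsto_expFlow_zero {A : X →L[ℂ] X} {C a : ℝ} (ha : 0 < a)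
    (hA : ∀ t, 0 ≤ t → ‖expFlow A t‖ ≤ C * Real.exp (-a * t)) (w : X) :
    Tendsto (fun t => expFlow A t w) atTop (𝓝 0) := by
  have h1 : Tendsto (fun t => C * Real.exp (-a * t) * ‖w‖) atTop (𝓝 (C * 0 * ‖w‖)) := by
    refine (Tendsto.const_mul _ ?_).mul_const _
    refine Real.tendsto_exp_atBot.comp ?_
    exact tendsto_id.const_mul_atTop_of_neg (by linarith)
  rw [mul_zero, zero_mul] at h1
  refine squeeze_zero_norm' ?_ h1
  filter_upwards [eventually_ge_atTop 0] with t ht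
  exact (ContinuousLinearMap.le_opNorm _ _).trans (by gcongr; exact hA t ht)

/-- The constant does not depend on `T`, so the tail energy vanishes with the final state. -/
lemma lintegral_enorm_sq_expFlow_le {Y : Type*} [NormedAddCommGroup Y] [NormedSpace ℂ Y]
    {A : X →L[ℂ] X} {C a : ℝ} (ha : 0 < a)
    (hA : ∀ t, 0 ≤ t → ‖expFlow A t‖ ≤ C * Real.exp (-a * t)) (H : X →L[ℂ] Y) (T : ℝ) (w : X) :
    ∫⁻ t in Set.Ioi T, ‖H (expFlow A (t - T) w)‖ₑ ^ 2 ≤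
      ENNReal.ofReal (‖H‖ ^ 2 * C ^ 2 / (2 * a)) * ‖w‖ₑ ^ 2 := by
  calc _ ≤ ∫⁻ t in Set.Ioi T, ENNReal.ofReal
        (‖H‖ ^ 2 * C ^ 2 * ‖w‖ ^ 2 * Real.exp (-(2 * a) * (t - T))) := by
        refine setLIntegral_mono_ae (by fun_prop) (ae_of_all _ fun t ht => ?_)
        rw [← ofReal_norm, ← ENNReal.ofReal_pow (norm_nonneg _)]
        refine ENNReal.ofReal_le_ofReal ?_
        have h1 : ‖H (expFlow A (t - T) w)‖ ≤ ‖H‖ * (C * Real.exp (-a * (t - T)) * ‖w‖) := by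
          refine (ContinuousLinearMap.le_opNorm _ _).trans ?_
          gcongr
          refine (ContinuousLinearMap.le_opNorm _ _).trans ?_
          gcongr
          exact hA _ (sub_nonneg.2 (Set.mem_Ioi.1 ht).le)
        calc _ ≤ (‖H‖ * (C * Real.exp (-a * (t - T)) * ‖w‖)) ^ 2 := by gcongr
          _ = ‖H‖ ^ 2 * C ^ 2 * ‖w‖ ^ 2 *
              (Real.exp (-a * (t - T)) * Real.exp (-a * (t - T))) := by ring
          _ = _ := by rw [← Real.exp_add]; congr 2; ring
    _ = _ := by
        rw [← ofReal_integral_eq_lintegral_ofReal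
          ((integrableOn_exp_neg_mul_sub (by positivity) T).const_mul _)
          (ae_of_all _ fun t => by positivity), integral_const_mul,
          integral_exp_neg_mul_sub (by positivity), ← ofReal_norm,
          ← ENNReal.ofReal_pow (norm_nonneg _), ← ENNReal.ofReal_mul (by positivity)]
        congr 1; ring

variable [CompleteSpace X]

lemma integrableOn_expFlow {A : X →L[ℂ] X} {C a : ℝ} (ha : 0 < a)
    (hA : ∀ t, 0 ≤ t → ‖expFlow A t‖ ≤ C * Real.exp (-a * t)) (T : ℝ) (w : X) :
    IntegrableOn (fun t => expFlow A (t - T) w) (Set.Ioi T) := by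
  refine Integrable.mono' ((integrableOn_exp_neg_mul_sub ha T).const_mul (C * ‖w‖))
    ((continuous_expFlow_apply A w).comp (continuous_sub_right T)).aestronglyMeasurable ?_
  refine (ae_restrict_mem measurableSet_Ioi).mono fun t ht => ?_
  calc _ ≤ ‖expFlow A (t - T)‖ * ‖w‖ := ContinuousLinearMap.le_opNorm _ _
    _ ≤ C * Real.exp (-a * (t - T)) * ‖w‖ := by
      gcongr; exact hA _ (sub_nonneg.2 (Set.mem_Ioi.1 ht).le)
    _ = _ := by ring

lemma norm_cexp_neg_mul_le {s : ℂ} (hs : 0 ≤ s.re) {t : ℝ} (ht : 0 ≤ t) :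
    ‖Complex.exp (-s * t)‖ ≤ 1 := by
  rw [Complex.norm_exp, Real.exp_le_one_iff]
  simp only [neg_mul, Complex.neg_re, Complex.re_mul_ofReal]
  nlinarith

/-- The Laplace transform of a decaying flow is the resolvent. -/
lemma smul_sub_setIntegral_expFlow {A : X →L[ℂ] X} {C a : ℝ} (ha : 0 < a)
    (hA : ∀ t, 0 ≤ t → ‖expFlow A t‖ ≤ C * Real.exp (-a * t)) {s : ℂ} (hs : 0 ≤ s.re)
    {T : ℝ} (hT : 0 ≤ T) (w : X) :
    s • (∫ t in Set.Ioi T, Complex.exp (-s * t) • expFlow A (t - T) w) -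
      A (∫ t in Set.Ioi T, Complex.exp (-s * t) • expFlow A (t - T) w) =
      Complex.exp (-s * T) • w := by
  have hcont : Continuous fun t : ℝ => expFlow A (t - T) w :=
    (continuous_expFlow_apply A w).comp (continuous_sub_right T)
  have hi : IntegrableOn (fun t : ℝ => Complex.exp (-s * t) • expFlow A (t - T) w)
      (Set.Ioi T) := by
    refine Integrable.mono (integrableOn_expFlow ha hA T w) ?_ ?_
    · exact (Continuous.smul (by fun_prop) hcont).aestronglyMeasurable
    · refine (ae_restrict_mem measurableSet_Ioi).mono fun t ht => ?_
      rw [norm_smul]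
      exact mul_le_of_le_one_left (norm_nonneg _)
        (norm_cexp_neg_mul_le hs (hT.trans (Set.mem_Ioi.1 ht).le))
  have hd : ∀ t : ℝ, HasDerivAt (fun t : ℝ => -(Complex.exp (-s * t) • expFlow A (t - T) w))
      (s • (Complex.exp (-s * t) • expFlow A (t - T) w) -
        A (Complex.exp (-s * t) • expFlow A (t - T) w)) t := fun t => by
    have h1 := ((Complex.ofRealCLM.hasDerivAt (x := t)).const_mul (-s)).cexp
    have h2 : HasDerivAt (fun t => expFlow A (t - T) w) (A (expFlow A (t - T) w)) t :=
      (hasDerivAt_expFlow A w (t - T)).comp_sub_const t T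
    convert! (h1.smul h2).neg using 1
    simp [smul_smul, mul_comm, sub_eq_add_neg]
  have hlim : Tendsto (fun t : ℝ => -(Complex.exp (-s * t) • expFlow A (t - T) w)) atTop
      (𝓝 0) := by
    have h1 : Tendsto (fun t => expFlow A (t - T) w) atTop (𝓝 0) :=
      (tendsto_expFlow_zero ha hA w).comp (tendsto_atTop_add_const_right _ _ tendsto_id)
    rw [← neg_zero]
    refine Tendsto.neg (squeeze_zero_norm' ?_ (tendsto_zero_iff_norm_tendsto_zero.1 h1))
    filter_upwards [eventually_ge_atTop 0] with t ht
    rw [norm_smul]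
    exact mul_le_of_le_one_left (norm_nonneg _) (norm_cexp_neg_mul_le hs ht)
  have key := integral_Ioi_of_hasDerivAt_of_tendsto' (a := T) (fun t _ => hd t)
    ((hi.smul s).sub (A.integrable_comp hi)) hlim
  have his : IntegrableOn (fun t : ℝ => s • Complex.exp (-s * t) • expFlow A (t - T) w)
      (Set.Ioi T) := hi.smul s
  rw [integral_sub his (A.integrable_comp hi), integral_smul,
    A.integral_comp_comm hi] at key
  rw [key]
  simp

end Laplace

/-! ### From the frequency domain inequality to the energy inequality. -/

section EnergyInequality

open FourierTransform

variable {X U P R : Type*}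
  [NormedAddCommGroup X] [InnerProductSpace ℂ X] [CompleteSpace X]
  [NormedAddCommGroup U] [InnerProductSpace ℂ U]
  [NormedAddCommGroup P] [InnerProductSpace ℂ P] [CompleteSpace P]
  [NormedAddCommGroup R] [InnerProductSpace ℂ R] [CompleteSpace R]

/-- The trajectory `x` on `(0, T]`, continued by the free flow on `(T, ∞)` and by zero on
`(-∞, 0]`. -/
def freeExtension (A : X →L[ℂ] X) (x : ℝ → X) (T : ℝ) : ℝ → X :=
  (Set.Ioc 0 T).indicator x + (Set.Ioi T).indicator fun t => expFlow A (t - T) (x T)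

lemma memLp_freeExtension {A : X →L[ℂ] X} {C a : ℝ} (ha : 0 < a)
    (hA : ∀ t, 0 ≤ t → ‖expFlow A t‖ ≤ C * Real.exp (-a * t)) {T : ℝ} {x : ℝ → X}
    (hx : ContinuousOn x (Set.Icc 0 T)) :
    MemLp (freeExtension A x T) 1 ∧ MemLp (freeExtension A x T) 2 := by
  have h1 : ∀ p, MemLp ((Set.Ioc 0 T).indicator x) p := fun p => by
    rw [memLp_indicator_iff_restrict measurableSet_Ioc]
    obtain ⟨M, hM⟩ := isCompact_Icc.exists_bound_of_continuousOn hx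
    refine MemLp.of_bound ?_ M ?_
    · exact (hx.mono Set.Ioc_subset_Icc_self).aestronglyMeasurable measurableSet_Ioc
    · exact (ae_restrict_mem measurableSet_Ioc).mono fun t ht => hM t ⟨ht.1.le, ht.2⟩
  have hcont : Continuous fun t : ℝ => expFlow A (t - T) (x T) :=
    (continuous_expFlow_apply A _).comp (continuous_sub_right T)
  refine ⟨(h1 1).add ?_, (h1 2).add ?_⟩
  · rw [memLp_indicator_iff_restrict measurableSet_Ioi, memLp_one_iff_integrable]
    exact integrableOn_expFlow ha hA T _
  · rw [memLp_indicator_iff_restrict measurableSet_Ioi]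
    refine ⟨hcont.aestronglyMeasurable, ?_⟩
    have h := lintegral_enorm_sq_expFlow_le ha hA (ContinuousLinearMap.id ℂ X) T (x T)
    simp only [ContinuousLinearMap.id_apply] at h
    rw [← eLpNorm_two_sq] at h
    have h' : eLpNorm (fun t => expFlow A (t - T) (x T)) 2 (volume.restrict (Set.Ioi T)) ^ 2 < ⊤ :=
      h.trans_lt (ENNReal.mul_lt_top ENNReal.ofReal_lt_top (by simp))
    simpa using h'

lemma lintegral_enorm_sq_freeExtension {Y : Type*} [NormedAddCommGroup Y] [NormedSpace ℂ Y]
    (A : X →L[ℂ] X) (H : X →L[ℂ] Y) (D : U →L[ℂ] Y) (x : ℝ → X) (u : ℝ → U) (T : ℝ) :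
    ∫⁻ t, ‖H (freeExtension A x T t) + D ((Set.Ioc 0 T).indicator u t)‖ₑ ^ 2 =
      (∫⁻ t in Set.Ioc 0 T, ‖H (x t) + D (u t)‖ₑ ^ 2) +
      ∫⁻ t in Set.Ioi T, ‖H (expFlow A (t - T) (x T))‖ₑ ^ 2 := by
  have hcont : Measurable fun t : ℝ => ‖H (expFlow A (t - T) (x T))‖ₑ ^ 2 :=
    (H.continuous.comp ((continuous_expFlow_apply A _).comp
      (continuous_sub_right T))).enorm.measurable.pow_const 2
  rw [← lintegral_indicator measurableSet_Ioc, ← lintegral_indicator measurableSet_Ioi,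
    ← lintegral_add_right _ (hcont.indicator measurableSet_Ioi)]
  refine lintegral_congr fun t => ?_
  by_cases h1 : t ∈ Set.Ioc 0 T
  · have h2 : t ∉ Set.Ioi T := not_lt.2 h1.2
    simp [freeExtension, h1, h2]
  · by_cases h2 : t ∈ Set.Ioi T <;> simp [freeExtension, h1, h2]

variable [CompleteSpace U]

lemma fourier_eq_integral_cexp_smul {Z : Type*} [NormedAddCommGroup Z] [NormedSpace ℂ Z]
    (f : ℝ → Z) (ξ : ℝ) :
    𝓕 f ξ = ∫ t : ℝ, Complex.exp (-(Complex.I * (2 * Real.pi * ξ : ℝ)) * t) • f t := by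
  rw [Real.fourier_real_eq_integral_exp_smul]
  refine integral_congr_ae (ae_of_all _ fun t => ?_)
  simp only
  congr 2; push_cast; ring

lemma integrableOn_cexp_smul {Z : Type*} [NormedAddCommGroup Z] [NormedSpace ℂ Z] (s : ℂ) {T : ℝ}
    {f : ℝ → Z} (hf : IntegrableOn f (Set.Ioc 0 T)) :
    IntegrableOn (fun t : ℝ => Complex.exp (-s * t) • f t) (Set.Ioc 0 T) := by
  refine (IntegrableOn.continuousOn_smul (K := Set.Icc 0 T) ?_
    (by fun_prop : Continuous fun t : ℝ => Complex.exp (-s * t)).continuousOn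
    isCompact_Icc).mono_set Set.Ioc_subset_Icc_self
  rwa [integrableOn_Icc_iff_integrableOn_Ioc]

lemma fourier_clm_add_clm {Y : Type*} [NormedAddCommGroup Y] [NormedSpace ℂ Y] [CompleteSpace Y]
    (H : X →L[ℂ] Y) (D : U →L[ℂ] Y) {f : ℝ → X} {h : ℝ → U} (hf : Integrable f)
    (hh : Integrable h) (ξ : ℝ) :
    𝓕 (fun t => H (f t) + D (h t)) ξ = H (𝓕 f ξ) + D (𝓕 h ξ) := by
  simp_rw [Real.fourier_real_eq]
  have j1 := (Real.fourierIntegral_convergent_iff (μ := volume) ξ).2 hf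
  have j2 := (Real.fourierIntegral_convergent_iff (μ := volume) ξ).2 hh
  simp only [RCLike.inner_apply, conj_trivial] at j1 j2
  simp_rw [mul_comm ξ] at j1 j2
  rw [← H.integral_comp_comm j1, ← D.integral_comp_comm j2,
    ← integral_add (H.integrable_comp j1) (D.integrable_comp j2)]
  refine integral_congr_ae (ae_of_all _ fun t => ?_)
  simp [Circle.smul_def]

lemma lintegral_enorm_sq_fourier_clm_add_clm {Y : Type*} [NormedAddCommGroup Y]
    [InnerProductSpace ℂ Y] [CompleteSpace Y]
    (H : X →L[ℂ] Y) (D : U →L[ℂ] Y) {f : ℝ → X} {h : ℝ → U} (f1 : MemLp f 1) (f2 : MemLp f 2)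
    (h1 : MemLp h 1) (h2 : MemLp h 2) :
    ∫⁻ ξ, ‖H (𝓕 f ξ) + D (𝓕 h ξ)‖ₑ ^ 2 = ∫⁻ t, ‖H (f t) + D (h t)‖ₑ ^ 2 := by
  have m : ∀ {p}, MemLp f p → MemLp h p → MemLp (fun t => H (f t) + D (h t)) p :=
    fun a b => (H.comp_memLp' a).add (D.comp_memLp' b)
  rw [← lintegral_enorm_sq_fourier (memLp_one_iff_integrable.1 (m f1 h1)) (m f2 h2)]
  refine lintegral_congr fun ξ => ?_
  rw [fourier_clm_add_clm H D (memLp_one_iff_integrable.1 f1) (memLp_one_iff_integrable.1 h1)]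

/-- The Fourier transform of an extended trajectory satisfies the frequency domain state
equation. -/
lemma smul_fourier_freeExtension {A : X →L[ℂ] X} {B : U →L[ℂ] X} {C a : ℝ} (ha : 0 < a)
    (hA : ∀ t, 0 ≤ t → ‖expFlow A t‖ ≤ C * Real.exp (-a * t)) {T : ℝ} (hT : 0 ≤ T)
    {x : ℝ → X} {u : ℝ → U} (hu : IntegrableOn u (Set.Ioc 0 T))
    (hxc : ContinuousOn x (Set.Icc 0 T))
    (hx : ∀ t ∈ Set.Icc 0 T, x t = ∫ τ in (0 : ℝ)..t, (A (x τ) + B (u τ))) (ξ : ℝ) :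
    (Complex.I * (2 * Real.pi * ξ : ℝ)) • 𝓕 (freeExtension A x T) ξ =
      A (𝓕 (freeExtension A x T) ξ) + B (𝓕 ((Set.Ioc 0 T).indicator u) ξ) := by
  set s : ℂ := Complex.I * (2 * Real.pi * ξ : ℝ) with hs
  have hs0 : 0 ≤ s.re := by simp [hs]
  have hxi : IntegrableOn x (Set.Ioc 0 T) :=
    (hxc.integrableOn_compact isCompact_Icc).mono_set Set.Ioc_subset_Icc_self
  have htail : IntegrableOn (fun t : ℝ => Complex.exp (-s * t) • expFlow A (t - T) (x T))
      (Set.Ioi T) := by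
    have hcont : Continuous fun t : ℝ => expFlow A (t - T) (x T) :=
      (continuous_expFlow_apply A _).comp (continuous_sub_right T)
    refine Integrable.mono (integrableOn_expFlow ha hA T (x T)) ?_ ?_
    · exact (Continuous.smul (by fun_prop) hcont).aestronglyMeasurable
    · refine (ae_restrict_mem measurableSet_Ioi).mono fun t ht => ?_
      rw [norm_smul]
      exact mul_le_of_le_one_left (norm_nonneg _)
        (norm_cexp_neg_mul_le hs0 (hT.trans (Set.mem_Ioi.1 ht).le))
  have e1 : 𝓕 ((Set.Ioc 0 T).indicator u) ξ =
      ∫ t in Set.Ioc 0 T, Complex.exp (-s * t) • u t := by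
    rw [fourier_eq_integral_cexp_smul, ← integral_indicator measurableSet_Ioc]
    simp_rw [Set.indicator_smul, hs]
  have e2 : 𝓕 (freeExtension A x T) ξ = (∫ t in Set.Ioc 0 T, Complex.exp (-s * t) • x t) +
      ∫ t in Set.Ioi T, Complex.exp (-s * t) • expFlow A (t - T) (x T) := by
    rw [fourier_eq_integral_cexp_smul, ← integral_indicator measurableSet_Ioc, ← integral_indicator measurableSet_Ioi,
      ← integral_add ((integrableOn_cexp_smul s hxi).integrable_indicator measurableSet_Ioc)
        (htail.integrable_indicator measurableSet_Ioi)]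
    simp_rw [freeExtension, Pi.add_apply, smul_add, Set.indicator_smul, hs]
  have hg : IntegrableOn (fun t => A (x t) + B (u t)) (Set.Ioc 0 T) :=
    (A.integrable_comp hxi).add (B.integrable_comp hu)
  have l1 := smul_setIntegral_exp_smul_primitive s hT hg hx
  have l2 := smul_sub_setIntegral_expFlow ha hA hs0 hT (x T)
  have l3 : ∫ t in Set.Ioc 0 T, Complex.exp (-s * t) • (A (x t) + B (u t)) =
      A (∫ t in Set.Ioc 0 T, Complex.exp (-s * t) • x t) +
      B (∫ t in Set.Ioc 0 T, Complex.exp (-s * t) • u t) := by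
    rw [← A.integral_comp_comm (integrableOn_cexp_smul s hxi), ← B.integral_comp_comm (integrableOn_cexp_smul s hu),
      ← integral_add (A.integrable_comp (integrableOn_cexp_smul s hxi)) (B.integrable_comp (integrableOn_cexp_smul s hu))]
    simp
  -- The boundary term `-e^{-sT} x(T)` of the truncated trajectory cancels against `+e^{-sT} x(T)`
  -- from the free tail. This is the reason for extending by the flow and not by zero.
  rw [e1, e2, smul_add, l1, l3, map_add, sub_eq_iff_eq_add.1 l2]
  abel

variable {g ε : ℝ≥0∞} {A : X →L[ℂ] X} {B : U →L[ℂ] X} {Cp : X →L[ℂ] P} {Dp : U →L[ℂ] P}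
  {Cr : X →L[ℂ] R} {Dr : U →L[ℂ] R} {x : ℝ → X} {u : ℝ → U}

/-- A frequency domain inequality implies an energy inequality on a finite horizon, up to the
energy of the free response from the final state. -/
theorem setLIntegral_output_le_of_frequency {C a : ℝ} (ha : 0 < a)
    (hA : ∀ t, 0 ≤ t → ‖expFlow A t‖ ≤ C * Real.exp (-a * t))
    (hfreq : ∀ (ω : ℝ) (z : X) (w : U), (Complex.I * ω) • z = A z + B w →
      ‖Cp z + Dp w‖ₑ ^ 2 ≤ g * (‖Cr z + Dr w‖ₑ ^ 2 + ε * ‖w‖ₑ ^ 2))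
    {T : ℝ} (hT : 0 ≤ T) (hu : MemLp u 2 (volume.restrict (Set.Icc 0 T)))
    (hxc : ContinuousOn x (Set.Icc 0 T))
    (hx : ∀ t ∈ Set.Icc 0 T, x t = ∫ τ in (0 : ℝ)..t, (A (x τ) + B (u τ))) :
    ∫⁻ t in Set.Ioc 0 T, ‖Cp (x t) + Dp (u t)‖ₑ ^ 2 ≤
      g * ((∫⁻ t in Set.Ioc 0 T, ‖Cr (x t) + Dr (u t)‖ₑ ^ 2) +
        ENNReal.ofReal (‖Cr‖ ^ 2 * C ^ 2 / (2 * a)) * ‖x T‖ₑ ^ 2 +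
        ε * ∫⁻ t in Set.Ioc 0 T, ‖u t‖ₑ ^ 2) := by
  obtain ⟨x1, x2⟩ := memLp_freeExtension ha hA hxc
  have hu' : MemLp u 2 (volume.restrict (Set.Ioc 0 T)) :=
    hu.mono_measure (Measure.restrict_mono Set.Ioc_subset_Icc_self le_rfl)
  have hu1 : IntegrableOn u (Set.Ioc 0 T) := hu'.integrable (by norm_num)
  have u1 : MemLp ((Set.Ioc 0 T).indicator u) 1 := by
    rw [memLp_one_iff_integrable]; exact hu1.integrable_indicator measurableSet_Ioc
  have u2 : MemLp ((Set.Ioc 0 T).indicator u) 2 := by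
    rwa [memLp_indicator_iff_restrict measurableSet_Ioc]
  -- The transformed state equation makes the hypothesis applicable at each `ω = 2πξ`.
  have hpw : ∀ ξ, _ := fun ξ => hfreq _ _ _ (smul_fourier_freeExtension ha hA hT hu1 hxc hx ξ)
  have hm : Continuous (𝓕 ((Set.Ioc 0 T).indicator u)) :=
    VectorFourier.fourierIntegral_continuous Real.continuous_fourierChar
      (by exact continuous_inner) (memLp_one_iff_integrable.1 u1)
  have hm' : Continuous (𝓕 (freeExtension A x T)) :=
    VectorFourier.fourierIntegral_continuous Real.continuous_fourierChar
      (by exact continuous_inner) (memLp_one_iff_integrable.1 x1)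
  have hm2 : Measurable fun ξ => ‖𝓕 ((Set.Ioc 0 T).indicator u) ξ‖ₑ ^ 2 := hm.enorm.measurable.pow_const 2
  have hm3 : Measurable fun ξ => ‖Cr (𝓕 (freeExtension A x T) ξ) +
      Dr (𝓕 ((Set.Ioc 0 T).indicator u) ξ)‖ₑ ^ 2 :=
    ((Cr.continuous.comp hm').add (Dr.continuous.comp hm)).enorm.measurable.pow_const 2
  -- On the left the energy of the tail may be dropped; on the right it must be paid for, by the
  -- term in `‖x T‖`.
  calc _ ≤ ∫⁻ t, ‖Cp (freeExtension A x T t) + Dp ((Set.Ioc 0 T).indicator u t)‖ₑ ^ 2 := by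
        rw [lintegral_enorm_sq_freeExtension]; exact le_self_add
    _ = _ := (lintegral_enorm_sq_fourier_clm_add_clm Cp Dp x1 x2 u1 u2).symm
    _ ≤ _ := lintegral_mono hpw
    _ = g * ((∫⁻ ξ, ‖Cr (𝓕 (freeExtension A x T) ξ) +
          Dr (𝓕 ((Set.Ioc 0 T).indicator u) ξ)‖ₑ ^ 2) +
          ε * ∫⁻ ξ, ‖𝓕 ((Set.Ioc 0 T).indicator u) ξ‖ₑ ^ 2) := by
        have hsum : Measurable fun ξ => ‖Cr (𝓕 (freeExtension A x T) ξ) +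
            Dr (𝓕 ((Set.Ioc 0 T).indicator u) ξ)‖ₑ ^ 2 +
            ε * ‖𝓕 ((Set.Ioc 0 T).indicator u) ξ‖ₑ ^ 2 := hm3.add (hm2.const_mul _)
        rw [lintegral_const_mul _ hsum,
          lintegral_add_left hm3, lintegral_const_mul _ hm2]
    _ ≤ _ := by
        rw [lintegral_enorm_sq_fourier_clm_add_clm Cr Dr x1 x2 u1 u2, lintegral_enorm_sq_fourier (memLp_one_iff_integrable.1 u1) u2,
          lintegral_enorm_sq_freeExtension]
        have e : ∫⁻ t, ‖(Set.Ioc 0 T).indicator u t‖ₑ ^ 2 =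
            ∫⁻ t in Set.Ioc 0 T, ‖u t‖ₑ ^ 2 := by
          rw [← lintegral_indicator measurableSet_Ioc]
          refine lintegral_congr fun t => ?_
          by_cases h : t ∈ Set.Ioc 0 T <;> simp [h]
        rw [e]
        gcongr
        exact lintegral_enorm_sq_expFlow_le ha hA Cr T (x T)

/-- A frequency domain inequality implies the corresponding energy inequality for all
trajectories from zero that tend to zero. -/
theorem lintegral_output_le_of_frequency {C a : ℝ} (ha : 0 < a)
    (hA : ∀ t, 0 ≤ t → ‖expFlow A t‖ ≤ C * Real.exp (-a * t)) (hg : g ≠ ⊤)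
    (hfreq : ∀ (ω : ℝ) (z : X) (w : U), (Complex.I * ω) • z = A z + B w →
      ‖Cp z + Dp w‖ₑ ^ 2 ≤ g * (‖Cr z + Dr w‖ₑ ^ 2 + ε * ‖w‖ₑ ^ 2))
    (hu : ∀ T, MemLp u 2 (volume.restrict (Set.Icc 0 T)))
    (hxc : ContinuousOn x (Set.Ici 0))
    (hx : ∀ t, 0 ≤ t → x t = ∫ τ in (0 : ℝ)..t, (A (x τ) + B (u τ)))
    (hlim : Tendsto x atTop (𝓝 0)) :
    ∫⁻ t in Set.Ici 0, ‖Cp (x t) + Dp (u t)‖ₑ ^ 2 ≤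
      g * ((∫⁻ t in Set.Ici 0, ‖Cr (x t) + Dr (u t)‖ₑ ^ 2) +
        ε * ∫⁻ t in Set.Ici 0, ‖u t‖ₑ ^ 2) := by
  set c : ℝ≥0∞ := ENNReal.ofReal (‖Cr‖ ^ 2 * C ^ 2 / (2 * a))
  simp_rw [setLIntegral_congr (Ioi_ae_eq_Ici (a := (0 : ℝ)) (μ := volume)).symm]
  have hfin : ∀ n : ℕ, ∫⁻ t in Set.Ioc 0 (n : ℝ), ‖Cp (x t) + Dp (u t)‖ₑ ^ 2 ≤
      g * ((∫⁻ t in Set.Ioi 0, ‖Cr (x t) + Dr (u t)‖ₑ ^ 2) + c * ‖x n‖ₑ ^ 2 +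
        ε * ∫⁻ t in Set.Ioi 0, ‖u t‖ₑ ^ 2) := fun n => by
    have hsub : Set.Ioc 0 (n : ℝ) ⊆ Set.Ioi 0 := Set.Ioc_subset_Ioi_self
    refine (setLIntegral_output_le_of_frequency ha hA hfreq n.cast_nonneg (hu n)
      (hxc.mono Set.Icc_subset_Ici_self) fun t ht => hx t ht.1).trans ?_
    gcongr
  have hl : Tendsto (fun n : ℕ => ∫⁻ t in Set.Ioc 0 (n : ℝ), ‖Cp (x t) + Dp (u t)‖ₑ ^ 2) atTop
      (𝓝 (∫⁻ t in Set.Ioi 0, ‖Cp (x t) + Dp (u t)‖ₑ ^ 2)) := by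
    have hU : Set.Ioi (0 : ℝ) = ⋃ n : ℕ, Set.Ioc 0 (n : ℝ) := by
      ext t
      simp only [Set.mem_Ioi, Set.mem_iUnion, Set.mem_Ioc]
      exact ⟨fun h => (exists_nat_ge t).imp fun n hn => ⟨h, hn⟩, fun ⟨_, h⟩ => h.1⟩
    have hmono : Monotone fun n : ℕ => Set.Ioc 0 (n : ℝ) := fun m n h =>
      Set.Ioc_subset_Ioc_right (Nat.cast_le.2 h)
    rw [hU, setLIntegral_iUnion_of_directed _ hmono.directed_le]
    exact tendsto_atTop_iSup fun m n h => lintegral_mono_set (hmono h)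
  -- The tail term disappears because the state tends to zero; `g ≠ ⊤` gives continuity of
  -- multiplication by `g` in `ℝ≥0∞`.
  have hr : Tendsto (fun n : ℕ => g * ((∫⁻ t in Set.Ioi 0, ‖Cr (x t) + Dr (u t)‖ₑ ^ 2) +
      c * ‖x n‖ₑ ^ 2 + ε * ∫⁻ t in Set.Ioi 0, ‖u t‖ₑ ^ 2)) atTop
      (𝓝 (g * ((∫⁻ t in Set.Ioi 0, ‖Cr (x t) + Dr (u t)‖ₑ ^ 2) +
      c * 0 + ε * ∫⁻ t in Set.Ioi 0, ‖u t‖ₑ ^ 2))) := by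
    refine ENNReal.Tendsto.const_mul ?_ (Or.inr hg)
    refine (Tendsto.const_add _ ?_).add_const _
    refine ENNReal.Tendsto.const_mul ?_ (Or.inr ENNReal.ofReal_ne_top)
    have h1 : Tendsto (fun n : ℕ => x n) atTop (𝓝 0) := hlim.comp tendsto_natCast_atTop_atTop
    simpa [Function.comp_def] using ((ENNReal.continuous_pow 2).tendsto _).comp h1.enorm
  simpa using le_of_tendsto_of_tendsto' hl hr hfin

end EnergyInequality

/-! ### From the energy inequality back to the frequency domain, by damped exponential inputs. -/

section ModulatedTrajectories

/-- Young's inequality with a free weight: the dominant term carries a factor `1 + η` that can be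
brought to `1`, at the price of a large factor on the transient. -/
lemma norm_add_sq_le_weighted {Y : Type*} [NormedAddCommGroup Y] {η : ℝ} (hη : 0 < η) (a b : Y) :
    ‖a + b‖ ^ 2 ≤ (1 + η) * ‖a‖ ^ 2 + (1 + 1 / η) * ‖b‖ ^ 2 := by
  have h1 : ‖a + b‖ ^ 2 ≤ (‖a‖ + ‖b‖) ^ 2 := by gcongr; exact norm_add_le a b
  have h2 : 2 * ‖a‖ * ‖b‖ ≤ η * ‖a‖ ^ 2 + 1 / η * ‖b‖ ^ 2 := by
    have := sq_nonneg (η * ‖a‖ - ‖b‖)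
    have h3 : η * ‖a‖ ^ 2 + 1 / η * ‖b‖ ^ 2 - 2 * ‖a‖ * ‖b‖ = (η * ‖a‖ - ‖b‖) ^ 2 / η := by
      field_simp; ring
    have h4 : 0 ≤ (η * ‖a‖ - ‖b‖) ^ 2 / η := by positivity
    linarith
  nlinarith

lemma enorm_add_sq_le_weighted {Y : Type*} [NormedAddCommGroup Y] {η : ℝ} (hη : 0 < η) (a b : Y) :
    ‖a + b‖ₑ ^ 2 ≤ ENNReal.ofReal (1 + η) * ‖a‖ₑ ^ 2 + ENNReal.ofReal (1 + 1 / η) * ‖b‖ₑ ^ 2 := by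
  simp_rw [← ofReal_norm, ← ENNReal.ofReal_pow (norm_nonneg _)]
  rw [← ENNReal.ofReal_mul (by positivity), ← ENNReal.ofReal_mul (by positivity),
    ← ENNReal.ofReal_add (by positivity) (by positivity)]
  exact ENNReal.ofReal_le_ofReal (norm_add_sq_le_weighted hη a b)

lemma lintegral_enorm_sq_cexp_smul {Y : Type*} [NormedAddCommGroup Y] [NormedSpace ℂ Y] {s : ℂ}
    {δ : ℝ} (hδ : 0 < δ) (hs : s.re = -δ) (w : Y) :
    ∫⁻ t in Set.Ici (0 : ℝ), ‖Complex.exp (s * t) • w‖ₑ ^ 2 =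
      ENNReal.ofReal (‖w‖ ^ 2 / (2 * δ)) := by
  rw [setLIntegral_congr (Ioi_ae_eq_Ici (a := (0 : ℝ)) (μ := volume)).symm]
  have h : ∀ t : ℝ, ‖Complex.exp (s * t) • w‖ₑ ^ 2 =
      ENNReal.ofReal (‖w‖ ^ 2 * Real.exp (-(2 * δ) * (t - 0))) := fun t => by
    rw [← ofReal_norm, ← ENNReal.ofReal_pow (norm_nonneg _), norm_smul, Complex.norm_exp]
    congr 1
    rw [Complex.re_mul_ofReal, hs, mul_pow, sq (Real.exp _), ← Real.exp_add, mul_comm]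
    congr 2; ring
  simp_rw [h]
  rw [← ofReal_integral_eq_lintegral_ofReal
    ((integrableOn_exp_neg_mul_sub (by positivity) 0).const_mul _)
    (ae_of_all _ fun t => by positivity), integral_const_mul,
    integral_exp_neg_mul_sub (by positivity), mul_one_div]

variable {X U P R : Type*}
  [NormedAddCommGroup X] [NormedSpace ℂ X]
  [NormedAddCommGroup U] [NormedSpace ℂ U]
  [NormedAddCommGroup P] [NormedSpace ℂ P]
  [NormedAddCommGroup R] [NormedSpace ℂ R]

lemma lintegral_enorm_sq_free_le {A : X →L[ℂ] X} {C a : ℝ} (ha : 0 < a)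
    (hA : ∀ t, 0 ≤ t → ‖expFlow A t‖ ≤ C * Real.exp (-a * t)) (H : X →L[ℂ] P) (z : X) :
    ∫⁻ t in Set.Ici (0 : ℝ), ‖H (expFlow A t z)‖ₑ ^ 2 ≤
      ENNReal.ofReal (‖H‖ ^ 2 * C ^ 2 / (2 * a) * ‖z‖ ^ 2) := by
  rw [setLIntegral_congr (Ioi_ae_eq_Ici (a := (0 : ℝ)) (μ := volume)).symm,
    ENNReal.ofReal_mul (by positivity), ENNReal.ofReal_pow (norm_nonneg _), ofReal_norm]
  simpa using lintegral_enorm_sq_expFlow_le ha hA H 0 z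

variable [CompleteSpace X]

lemma measurable_enorm_sq_free (A : X →L[ℂ] X) (H : X →L[ℂ] P) (z : X) :
    Measurable fun t : ℝ => ‖H (expFlow A t z)‖ₑ ^ 2 :=
  (H.continuous.comp (continuous_expFlow_apply A z)).enorm.measurable.pow_const 2

/-- The exponential has energy `‖w‖² / (2δ)`, which blows up as `δ → 0`, whereas the transient
contributes an amount independent of `δ`. The next lemma is the matching lower bound. -/
lemma lintegral_modulated_output_le {A : X →L[ℂ] X} {C a : ℝ} (ha : 0 < a)
    (hA : ∀ t, 0 ≤ t → ‖expFlow A t‖ ≤ C * Real.exp (-a * t)) (H : X →L[ℂ] P)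
    {s : ℂ} {δ : ℝ} (hδ : 0 < δ) (hs : s.re = -δ) {η : ℝ} (hη : 0 < η) (w : P) (z : X) :
    ∫⁻ t in Set.Ici (0 : ℝ), ‖Complex.exp (s * t) • w - H (expFlow A t z)‖ₑ ^ 2 ≤
      ENNReal.ofReal ((1 + η) * (‖w‖ ^ 2 / (2 * δ)) +
        (1 + 1 / η) * (‖H‖ ^ 2 * C ^ 2 / (2 * a) * ‖z‖ ^ 2)) := by
  have hm := (measurable_enorm_sq_free A H z).const_mul (ENNReal.ofReal (1 + 1 / η))
  have hm' : Measurable fun t : ℝ => ‖Complex.exp (s * t) • w‖ₑ ^ 2 :=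
    (Continuous.smul (by fun_prop) continuous_const).enorm.measurable.pow_const 2
  calc _ ≤ ∫⁻ t in Set.Ici (0 : ℝ), (ENNReal.ofReal (1 + η) * ‖Complex.exp (s * t) • w‖ₑ ^ 2 +
        ENNReal.ofReal (1 + 1 / η) * ‖H (expFlow A t z)‖ₑ ^ 2) := by
        refine lintegral_mono fun t => ?_
        rw [sub_eq_add_neg, ← enorm_neg (H _)]
        exact enorm_add_sq_le_weighted hη _ _
    _ ≤ _ := by
        rw [lintegral_add_right _ hm, lintegral_const_mul _ hm',
          lintegral_const_mul _ (measurable_enorm_sq_free A H z),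
          lintegral_enorm_sq_cexp_smul hδ hs,
          ENNReal.ofReal_add (p := (1 + η) * _) (by positivity) (by positivity),
          ENNReal.ofReal_mul (p := 1 + η) (by positivity), ENNReal.ofReal_mul (p := 1 + 1 / η) (by positivity)]
        gcongr
        exact lintegral_enorm_sq_free_le ha hA H z

lemma le_lintegral_modulated_output {A : X →L[ℂ] X} {C a : ℝ} (ha : 0 < a)
    (hA : ∀ t, 0 ≤ t → ‖expFlow A t‖ ≤ C * Real.exp (-a * t)) (H : X →L[ℂ] P)
    {s : ℂ} {δ : ℝ} (hδ : 0 < δ) (hs : s.re = -δ) {η : ℝ} (hη : 0 < η) (w : P) (z : X) :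
    ENNReal.ofReal (‖w‖ ^ 2 / (2 * δ)) ≤ ENNReal.ofReal (1 + η) *
        (∫⁻ t in Set.Ici (0 : ℝ), ‖Complex.exp (s * t) • w - H (expFlow A t z)‖ₑ ^ 2) +
      ENNReal.ofReal ((1 + 1 / η) * (‖H‖ ^ 2 * C ^ 2 / (2 * a) * ‖z‖ ^ 2)) := by
  have hm := (measurable_enorm_sq_free A H z).const_mul (ENNReal.ofReal (1 + 1 / η))
  have hm' : Measurable fun t : ℝ => ‖Complex.exp (s * t) • w - H (expFlow A t z)‖ₑ ^ 2 :=
    ((Continuous.smul (by fun_prop) continuous_const).sub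
      (H.continuous.comp (continuous_expFlow_apply A z))).enorm.measurable.pow_const 2
  rw [← lintegral_enorm_sq_cexp_smul hδ hs]
  calc _ ≤ ∫⁻ t in Set.Ici (0 : ℝ), (ENNReal.ofReal (1 + η) *
        ‖Complex.exp (s * t) • w - H (expFlow A t z)‖ₑ ^ 2 +
        ENNReal.ofReal (1 + 1 / η) * ‖H (expFlow A t z)‖ₑ ^ 2) := by
        refine lintegral_mono fun t => ?_
        have := enorm_add_sq_le_weighted hη (Complex.exp (s * t) • w - H (expFlow A t z))
          (H (expFlow A t z))
        rwa [sub_add_cancel] at this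
    _ ≤ _ := by
        rw [lintegral_add_right _ hm, lintegral_const_mul _ hm',
          lintegral_const_mul _ (measurable_enorm_sq_free A H z),
          ENNReal.ofReal_mul (p := 1 + 1 / η) (by positivity)]
        gcongr
        exact lintegral_enorm_sq_free_le ha hA H z

variable {g ε : ℝ} {A : X →L[ℂ] X} {B : U →L[ℂ] X} {Cp : X →L[ℂ] P} {Dp : U →L[ℂ] P}
  {Cr : X →L[ℂ] R} {Dr : U →L[ℂ] R}

/-- An energy inequality for smooth trajectories from zero, tested on the response to a damped
exponential input. -/
lemma norm_sq_le_of_energy {C a : ℝ} (ha : 0 < a)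
    (hA : ∀ t, 0 ≤ t → ‖expFlow A t‖ ≤ C * Real.exp (-a * t)) (hg : 0 ≤ g) (hε : 0 ≤ ε)
    (hE : ∀ (u : ℝ → U) (x : ℝ → X), Continuous u → Continuous x →
      (∀ t, HasDerivAt x (A (x t) + B (u t)) t) → x 0 = 0 → Tendsto x atTop (𝓝 0) →
      ∫⁻ t in Set.Ici 0, ‖Cp (x t) + Dp (u t)‖ₑ ^ 2 ≤
        ENNReal.ofReal g * ((∫⁻ t in Set.Ici 0, ‖Cr (x t) + Dr (u t)‖ₑ ^ 2) +
          ENNReal.ofReal ε * ∫⁻ t in Set.Ici 0, ‖u t‖ₑ ^ 2))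
    {s : ℂ} {δ : ℝ} (hδ : 0 < δ) (hs : s.re = -δ) {η : ℝ} (hη : 0 < η) {z : X} {v : U}
    (hz : s • z = A z + B v) :
    ‖Cp z + Dp v‖ ^ 2 ≤ (1 + η) * (g * ((1 + η) * ‖Cr z + Dr v‖ ^ 2 +
        2 * δ * ((1 + 1 / η) * (‖Cr‖ ^ 2 * C ^ 2 / (2 * a) * ‖z‖ ^ 2)) + ε * ‖v‖ ^ 2)) +
      2 * δ * ((1 + 1 / η) * (‖Cp‖ ^ 2 * C ^ 2 / (2 * a) * ‖z‖ ^ 2)) := by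
  set u : ℝ → U := fun t => Complex.exp (s * t) • v with hu
  -- The response `e^{st} z` starts at `z`; subtracting the free response from `z` makes it start at
  -- zero.
  set x : ℝ → X := fun t => Complex.exp (s * t) • z - expFlow A t z with hx
  have hd : ∀ t, HasDerivAt x (A (x t) + B (u t)) t := fun t => by
    have h1 := ((Complex.ofRealCLM.hasDerivAt (x := t)).const_mul s).cexp
    convert! (h1.smul_const z).sub (hasDerivAt_expFlow A z t) using 1
    simp only [hx, hu, map_sub, map_smul, Complex.ofRealCLM_apply, Complex.ofReal_one, mul_one,
      mul_smul, hz, smul_add]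
    abel
  have hu0 : Continuous u := Continuous.smul (by fun_prop) continuous_const
  have hx0 : Continuous x := continuous_iff_continuousAt.2 fun t => (hd t).continuousAt
  have hlim : Tendsto x atTop (𝓝 0) := by
    rw [← sub_zero (0 : X)]
    refine Tendsto.sub ?_ (tendsto_expFlow_zero ha hA z)
    have h1 : Tendsto (fun t : ℝ => Real.exp (-δ * t) * ‖z‖) atTop (𝓝 (0 * ‖z‖)) :=
      (Real.tendsto_exp_atBot.comp
        (tendsto_id.const_mul_atTop_of_neg (by linarith))).mul_const _
    rw [zero_mul] at h1
    refine squeeze_zero_norm (fun t => ?_) h1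
    rw [norm_smul, Complex.norm_exp, Complex.re_mul_ofReal, hs]
  have hy : ∀ t : ℝ, Cp (x t) + Dp (u t) =
        Complex.exp (s * t) • (Cp z + Dp v) - Cp (expFlow A t z) := by
    intro t
    simp only [hx, hu, map_sub, map_smul, smul_add]
    abel
  have hy' : ∀ t : ℝ, Cr (x t) + Dr (u t) =
        Complex.exp (s * t) • (Cr z + Dr v) - Cr (expFlow A t z) := by
    intro t
    simp only [hx, hu, map_sub, map_smul, smul_add]
    abel
  have key := hE u x hu0 hx0 hd (by simp [hx]) hlim
  simp_rw [hy, hy'] at key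
  have lower := le_lintegral_modulated_output ha hA Cp hδ hs hη (Cp z + Dp v) z
  have upper := lintegral_modulated_output_le ha hA Cr hδ hs hη (Cr z + Dr v) z
  have hue := lintegral_enorm_sq_cexp_smul hδ hs v
  have total : ENNReal.ofReal (‖Cp z + Dp v‖ ^ 2 / (2 * δ)) ≤
      ENNReal.ofReal ((1 + η) * (g * ((1 + η) * (‖Cr z + Dr v‖ ^ 2 / (2 * δ)) +
        (1 + 1 / η) * (‖Cr‖ ^ 2 * C ^ 2 / (2 * a) * ‖z‖ ^ 2) + ε * (‖v‖ ^ 2 / (2 * δ)))) +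
      (1 + 1 / η) * (‖Cp‖ ^ 2 * C ^ 2 / (2 * a) * ‖z‖ ^ 2)) := by
    refine lower.trans ?_
    rw [ENNReal.ofReal_add (p := (1 + η) * _) (by positivity) (by positivity),
      ENNReal.ofReal_mul (p := 1 + η) (by positivity), ENNReal.ofReal_mul (p := g) hg,
      ENNReal.ofReal_add (q := ε * _) (by positivity) (by positivity), ENNReal.ofReal_mul hε]
    gcongr
    refine key.trans ?_
    rw [hue]
    gcongr
  rw [ENNReal.ofReal_le_ofReal_iff (by positivity), div_le_iff₀ (by positivity)] at total
  refine total.trans (le_of_eq ?_)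
  field_simp

/-- An energy inequality for trajectories from zero that tend to zero implies the frequency domain
inequality on the imaginary axis. -/
theorem frequency_of_energy {C a : ℝ} (ha : 0 < a)
    (hA : ∀ t, 0 ≤ t → ‖expFlow A t‖ ≤ C * Real.exp (-a * t)) (hg : 0 ≤ g) (hε : 0 ≤ ε)
    (hE : ∀ (u : ℝ → U) (x : ℝ → X), Continuous u → Continuous x →
      (∀ t, HasDerivAt x (A (x t) + B (u t)) t) → x 0 = 0 → Tendsto x atTop (𝓝 0) →
      ∫⁻ t in Set.Ici 0, ‖Cp (x t) + Dp (u t)‖ₑ ^ 2 ≤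
        ENNReal.ofReal g * ((∫⁻ t in Set.Ici 0, ‖Cr (x t) + Dr (u t)‖ₑ ^ 2) +
          ENNReal.ofReal ε * ∫⁻ t in Set.Ici 0, ‖u t‖ₑ ^ 2))
    {ω : ℝ} (hω : Complex.I * ω ∈ resolventSet ℂ A) {z : X} {v : U}
    (hz : (Complex.I * ω) • z = A z + B v) :
    ‖Cp z + Dp v‖ ^ 2 ≤ g * (‖Cr z + Dr v‖ ^ 2 + ε * ‖v‖ ^ 2) := by
  -- The imaginary axis is approached from the left, so that the inputs decay. The resolvent set is
  -- open, hence contains `s δ` for small `δ`.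
  set s : ℝ → ℂ := fun δ => Complex.I * ω - δ with hs
  have hs0 : s 0 = Complex.I * ω := by simp [hs]
  have hsc : Continuous s := by fun_prop
  set ζ : ℝ → X := fun δ => resolvent A (s δ) (B v) with hζ
  have hres : ∀ k ∈ resolventSet ℂ A, ∀ w, (k • resolvent A k w - A (resolvent A k w) = w) ∧
      (resolvent A k (k • w - A w) = w) := fun k hk w => by
    have h1 := Ring.mul_inverse_cancel _ hk
    have h2 := Ring.inverse_mul_cancel _ hk
    have h1' := congrArg (fun T : X →L[ℂ] X => T w) h1
    have h2' := congrArg (fun T : X →L[ℂ] X => T w) h2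
    simp only [Algebra.algebraMap_eq_smul_one] at h1' h2'
    simp only [resolvent, Algebra.algebraMap_eq_smul_one]
    exact ⟨by simpa using h1', by simpa using h2'⟩
  have hζ0 : ζ 0 = z := by
    simp only [hζ, hs0]
    rw [show B v = (Complex.I * ω) • z - A z by rw [hz]; abel]
    exact (hres _ hω z).2
  have hζc : ContinuousAt ζ 0 := by
    have h1 : ContinuousAt (resolvent A) (s 0) := by
      rw [hs0]; exact (spectrum.hasDerivAt_resolvent_const_left hω).continuousAt
    have h2 : ContinuousAt (fun δ => resolvent A (s δ)) 0 :=
      ContinuousAt.comp (f := s) h1 hsc.continuousAt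
    exact h2.clm_apply continuousAt_const
  have hev : ∀ᶠ δ in 𝓝[>] (0 : ℝ), 0 < δ ∧ s δ ∈ resolventSet ℂ A := by
    refine (eventually_mem_nhdsWithin).and (nhdsWithin_le_nhds ?_)
    refine hsc.continuousAt.eventually_mem ?_
    rw [hs0]
    exact (spectrum.isOpen_resolventSet A).mem_nhds hω
  -- The order of limits matters: `δ → 0` at fixed `η` removes the terms `2δ (1 + 1/η)`, and only
  -- then may `η → 0`.
  have hη : ∀ η : ℝ, 0 < η → ‖Cp z + Dp v‖ ^ 2 ≤
      (1 + η) * (g * ((1 + η) * ‖Cr z + Dr v‖ ^ 2 + ε * ‖v‖ ^ 2)) := by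
    intro η hη
    have hl : Tendsto (fun δ => ‖Cp (ζ δ) + Dp v‖ ^ 2) (𝓝[>] 0) (𝓝 (‖Cp (ζ 0) + Dp v‖ ^ 2)) := by
      have : ContinuousAt (fun δ => ‖Cp (ζ δ) + Dp v‖ ^ 2) 0 := by fun_prop
      exact this.tendsto.mono_left nhdsWithin_le_nhds
    have hr : ContinuousAt (fun δ => (1 + η) * (g * ((1 + η) * ‖Cr (ζ δ) + Dr v‖ ^ 2 +
        2 * δ * ((1 + 1 / η) * (‖Cr‖ ^ 2 * C ^ 2 / (2 * a) * ‖ζ δ‖ ^ 2)) + ε * ‖v‖ ^ 2)) +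
        2 * δ * ((1 + 1 / η) * (‖Cp‖ ^ 2 * C ^ 2 / (2 * a) * ‖ζ δ‖ ^ 2))) 0 := by fun_prop
    have := le_of_tendsto_of_tendsto hl (hr.tendsto.mono_left nhdsWithin_le_nhds)
      (hev.mono fun δ hδ => norm_sq_le_of_energy ha hA hg hε hE hδ.1 (by simp [hs]) hη
        (sub_eq_iff_eq_add'.1 (hres _ hδ.2 (B v)).1))
    simpa [hζ0] using this
  have hl : ContinuousAt (fun η : ℝ =>
      (1 + η) * (g * ((1 + η) * ‖Cr z + Dr v‖ ^ 2 + ε * ‖v‖ ^ 2))) 0 := by fun_prop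
  have := ge_of_tendsto (hl.tendsto.mono_left (nhdsWithin_le_nhds (s := Set.Ioi 0)))
    (eventually_mem_nhdsWithin.mono fun η h => hη η h)
  simpa using this

end ModulatedTrajectories

/-! ### Eigenvalues of the Hamiltonian matrix and singularity of the Popov function. -/

section HamiltonianAlgebra

variable {𝕜 : Type*} [Field 𝕜] {ι κ π ρ : Type*} [Fintype ι] [Fintype κ] [Fintype π] [Fintype ρ]
  [DecidableEq κ]
  {A : Matrix ι ι 𝕜} {B : Matrix ι κ 𝕜} {Cp : Matrix π ι 𝕜} {Dp : Matrix π κ 𝕜}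
  {Cr : Matrix ρ ι 𝕜} {Dr : Matrix ρ κ 𝕜} {γ ε s : 𝕜} {W : Matrix κ κ 𝕜} {Q L : Matrix ι ι 𝕜}

/-- The stationarity equations of the optimal control problem with multiplier `l` at the complex
frequency `s`. -/
structure IsStationaryPoint (A : Matrix ι ι 𝕜) (B : Matrix ι κ 𝕜) (Cp : Matrix π ι 𝕜)
    (Dp : Matrix π κ 𝕜) (Cr : Matrix ρ ι 𝕜) (Dr : Matrix ρ κ 𝕜) (γ ε s : 𝕜)
    (x l : ι → 𝕜) (u : κ → 𝕜) : Prop where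
  state : s • x = A *ᵥ x + B *ᵥ u
  costate : s • l = Cpᵀ *ᵥ (Cp *ᵥ x + Dp *ᵥ u) - γ • (Crᵀ *ᵥ (Cr *ᵥ x + Dr *ᵥ u)) - Aᵀ *ᵥ l
  input : Bᵀ *ᵥ l + γ • (Drᵀ *ᵥ (Cr *ᵥ x + Dr *ᵥ u)) + (γ * ε) • u
    - Dpᵀ *ᵥ (Cp *ᵥ x + Dp *ᵥ u) = 0

/-- Here `W` is `𝒟⁻¹`: the input equation reads `𝒟 u = (D_pᵀ C_p - γ D_rᵀ C_r) x - Bᵀ l`, hence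
determines `u`. Symmetry of `W` is what makes the costate block equal to `-(A + B K)ᵀ`. -/
lemma isStationaryPoint_iff_eigenvector
    (hW : (γ • (Drᵀ * Dr) + (γ * ε) • (1 : Matrix κ κ 𝕜) - Dpᵀ * Dp) * W = 1)
    (hWt : Wᵀ = W) (x l : ι → 𝕜) (u : κ → 𝕜) :
    IsStationaryPoint A B Cp Dp Cr Dr γ ε s x l u ↔
      u = (W * (Dpᵀ * Cp - γ • (Drᵀ * Cr))) *ᵥ x - W *ᵥ (Bᵀ *ᵥ l) ∧
      s • x = (A + B * (W * (Dpᵀ * Cp - γ • (Drᵀ * Cr)))) *ᵥ x + (-(B * W * Bᵀ)) *ᵥ l ∧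
      s • l = (-(γ • (Crᵀ * (Cr + Dr * (W * (Dpᵀ * Cp - γ • (Drᵀ * Cr)))))) +
        Cpᵀ * (Cp + Dp * (W * (Dpᵀ * Cp - γ • (Drᵀ * Cr))))) *ᵥ x +
        (-(A + B * (W * (Dpᵀ * Cp - γ • (Drᵀ * Cr))))ᵀ) *ᵥ l := by
  have hW' : W * (γ • (Drᵀ * Dr) + (γ * ε) • (1 : Matrix κ κ 𝕜) - Dpᵀ * Dp) = 1 :=
    mul_eq_one_comm.1 hW
  have input_iff : (Bᵀ *ᵥ l + γ • (Drᵀ *ᵥ (Cr *ᵥ x + Dr *ᵥ u)) + (γ * ε) • u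
      - Dpᵀ *ᵥ (Cp *ᵥ x + Dp *ᵥ u) = 0) ↔
      u = (W * (Dpᵀ * Cp - γ • (Drᵀ * Cr))) *ᵥ x - W *ᵥ (Bᵀ *ᵥ l) := by
    have e : Bᵀ *ᵥ l + γ • (Drᵀ *ᵥ (Cr *ᵥ x + Dr *ᵥ u)) + (γ * ε) • u
        - Dpᵀ *ᵥ (Cp *ᵥ x + Dp *ᵥ u) =
        (γ • (Drᵀ * Dr) + (γ * ε) • (1 : Matrix κ κ 𝕜) - Dpᵀ * Dp) *ᵥ u -
        ((Dpᵀ * Cp - γ • (Drᵀ * Cr)) *ᵥ x - Bᵀ *ᵥ l) := by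
      simp only [Matrix.add_mulVec, Matrix.sub_mulVec, Matrix.smul_mulVec, Matrix.mulVec_add,
        ← Matrix.mulVec_mulVec, Matrix.one_mulVec]
      module
    rw [e, sub_eq_zero, ← Matrix.mulVec_mulVec, ← Matrix.mulVec_sub]
    constructor
    · intro h
      rw [← h, Matrix.mulVec_mulVec, hW', Matrix.one_mulVec]
    · intro h
      rw [h, Matrix.mulVec_mulVec, hW, Matrix.one_mulVec]
  have state_eq : ∀ u, u = (W * (Dpᵀ * Cp - γ • (Drᵀ * Cr))) *ᵥ x - W *ᵥ (Bᵀ *ᵥ l) →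
      A *ᵥ x + B *ᵥ u =
      (A + B * (W * (Dpᵀ * Cp - γ • (Drᵀ * Cr)))) *ᵥ x + (-(B * W * Bᵀ)) *ᵥ l := by
    rintro u rfl
    simp only [Matrix.add_mulVec, Matrix.neg_mulVec, Matrix.mulVec_sub, ← Matrix.mulVec_mulVec]
    abel
  have costate_eq : ∀ u, u = (W * (Dpᵀ * Cp - γ • (Drᵀ * Cr))) *ᵥ x - W *ᵥ (Bᵀ *ᵥ l) →
      Cpᵀ *ᵥ (Cp *ᵥ x + Dp *ᵥ u) - γ • (Crᵀ *ᵥ (Cr *ᵥ x + Dr *ᵥ u)) - Aᵀ *ᵥ l =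
      (-(γ • (Crᵀ * (Cr + Dr * (W * (Dpᵀ * Cp - γ • (Drᵀ * Cr)))))) +
        Cpᵀ * (Cp + Dp * (W * (Dpᵀ * Cp - γ • (Drᵀ * Cr))))) *ᵥ x +
        (-(A + B * (W * (Dpᵀ * Cp - γ • (Drᵀ * Cr))))ᵀ) *ᵥ l := by
    rintro u rfl
    simp only [Matrix.transpose_add, Matrix.transpose_mul, Matrix.transpose_sub,
      Matrix.transpose_smul, Matrix.transpose_transpose, hWt, Matrix.add_mulVec,
      Matrix.neg_mulVec, Matrix.sub_mulVec, Matrix.smul_mulVec, Matrix.mulVec_add,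
      Matrix.mulVec_sub, Matrix.mulVec_smul, ← Matrix.mulVec_mulVec]
    module
  constructor
  · rintro ⟨h1, h2, h3⟩
    have hu := input_iff.1 h3
    exact ⟨hu, h1.trans (state_eq u hu), h2.trans (costate_eq u hu)⟩
  · rintro ⟨hu, h1, h2⟩
    exact ⟨h1.trans (state_eq u hu).symm, h2.trans (costate_eq u hu).symm, input_iff.2 hu⟩

variable [DecidableEq ι]

/-- The complementary elimination: the resolvents `Q` and `L` solve the state and costate equations,
and what remains is the input equation in `u` alone. -/
lemma isStationaryPoint_iff_popov (hQ : (s • (1 : Matrix ι ι 𝕜) - A) * Q = 1)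
    (hL : (-s • (1 : Matrix ι ι 𝕜) - Aᵀ) * L = 1) (x l : ι → 𝕜) (u : κ → 𝕜) :
    IsStationaryPoint A B Cp Dp Cr Dr γ ε s x l u ↔
      x = Q *ᵥ (B *ᵥ u) ∧
      l = L *ᵥ (γ • (Crᵀ *ᵥ (Cr *ᵥ x + Dr *ᵥ u)) - Cpᵀ *ᵥ (Cp *ᵥ x + Dp *ᵥ u)) ∧
      (γ • ((Bᵀ * L * Crᵀ + Drᵀ) * (Cr * Q * B + Dr)) + (γ * ε) • (1 : Matrix κ κ 𝕜) -
        (Bᵀ * L * Cpᵀ + Dpᵀ) * (Cp * Q * B + Dp)) *ᵥ u = 0 := by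
  have hQ' := mul_eq_one_comm.1 hQ
  have hL' := mul_eq_one_comm.1 hL
  have solve : ∀ {T V : Matrix ι ι 𝕜}, T * V = 1 → ∀ a b : ι → 𝕜, T *ᵥ a = b ↔ a = V *ᵥ b := by
    intro T V h a b
    constructor
    · rintro rfl
      rw [Matrix.mulVec_mulVec, mul_eq_one_comm.1 h, Matrix.one_mulVec]
    · rintro rfl
      rw [Matrix.mulVec_mulVec, h, Matrix.one_mulVec]
  have h1 : (s • x = A *ᵥ x + B *ᵥ u) ↔ x = Q *ᵥ (B *ᵥ u) := by
    rw [← solve hQ, Matrix.sub_mulVec, Matrix.smul_mulVec, Matrix.one_mulVec, sub_eq_iff_eq_add']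
  have h2 : (s • l = Cpᵀ *ᵥ (Cp *ᵥ x + Dp *ᵥ u) - γ • (Crᵀ *ᵥ (Cr *ᵥ x + Dr *ᵥ u)) - Aᵀ *ᵥ l) ↔
      l = L *ᵥ (γ • (Crᵀ *ᵥ (Cr *ᵥ x + Dr *ᵥ u)) - Cpᵀ *ᵥ (Cp *ᵥ x + Dp *ᵥ u)) := by
    rw [← solve hL, Matrix.sub_mulVec, Matrix.smul_mulVec, Matrix.one_mulVec]
    constructor <;> intro h
    · rw [neg_smul, h]; abel
    · rw [← sub_eq_zero] at h ⊢
      rw [← neg_eq_zero, ← h]; module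
  have h3 : x = Q *ᵥ (B *ᵥ u) →
      l = L *ᵥ (γ • (Crᵀ *ᵥ (Cr *ᵥ x + Dr *ᵥ u)) - Cpᵀ *ᵥ (Cp *ᵥ x + Dp *ᵥ u)) →
      Bᵀ *ᵥ l + γ • (Drᵀ *ᵥ (Cr *ᵥ x + Dr *ᵥ u)) + (γ * ε) • u - Dpᵀ *ᵥ (Cp *ᵥ x + Dp *ᵥ u) =
      (γ • ((Bᵀ * L * Crᵀ + Drᵀ) * (Cr * Q * B + Dr)) + (γ * ε) • (1 : Matrix κ κ 𝕜) -
        (Bᵀ * L * Cpᵀ + Dpᵀ) * (Cp * Q * B + Dp)) *ᵥ u := by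
    rintro rfl rfl
    simp only [Matrix.add_mulVec, Matrix.sub_mulVec, Matrix.smul_mulVec, Matrix.mulVec_add,
      Matrix.mulVec_sub, Matrix.mulVec_smul, ← Matrix.mulVec_mulVec, Matrix.one_mulVec]
    module
  constructor
  · rintro ⟨a, b, c⟩
    have a' := h1.1 a
    have b' := h2.1 b
    exact ⟨a', b', (h3 a' b').symm.trans c⟩
  · rintro ⟨a, b, c⟩
    exact ⟨h1.2 a, h2.2 b, (h3 a b).trans c⟩

lemma hasEigenvalue_toLin'_iff {M : Matrix ι ι 𝕜} {μ : 𝕜} :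
    Module.End.HasEigenvalue (Matrix.toLin' M) μ ↔ ∃ v ≠ 0, μ • v = M *ᵥ v := by
  constructor
  · intro h
    obtain ⟨v, hv⟩ := h.exists_hasEigenvector
    exact ⟨v, hv.2, by simpa using hv.apply_eq_smul.symm⟩
  · rintro ⟨v, hv, h⟩
    exact Module.End.hasEigenvalue_of_hasEigenvector
      (x := v) ⟨Module.End.mem_eigenspace_iff.2 (by simpa using h.symm), hv⟩

/-- A point `s` such that neither `s` is an eigenvalue of `A` nor `-s` is one of `Aᵀ` is an
eigenvalue of the Hamiltonian matrix if and only if the Popov function is singular at `s`. -/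
theorem hasEigenvalue_hamiltonian_iff
    (hW : (γ • (Drᵀ * Dr) + (γ * ε) • (1 : Matrix κ κ 𝕜) - Dpᵀ * Dp) * W = 1)
    (hWt : Wᵀ = W) (hQ : (s • (1 : Matrix ι ι 𝕜) - A) * Q = 1)
    (hL : (-s • (1 : Matrix ι ι 𝕜) - Aᵀ) * L = 1) :
    Module.End.HasEigenvalue (Matrix.toLin' (Matrix.fromBlocks
      (A + B * (W * (Dpᵀ * Cp - γ • (Drᵀ * Cr)))) (-(B * W * Bᵀ))
      (-(γ • (Crᵀ * (Cr + Dr * (W * (Dpᵀ * Cp - γ • (Drᵀ * Cr)))))) +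
        Cpᵀ * (Cp + Dp * (W * (Dpᵀ * Cp - γ • (Drᵀ * Cr)))))
      (-(A + B * (W * (Dpᵀ * Cp - γ • (Drᵀ * Cr))))ᵀ))) s ↔
    ∃ u ≠ 0, (γ • ((Bᵀ * L * Crᵀ + Drᵀ) * (Cr * Q * B + Dr)) + (γ * ε) • (1 : Matrix κ κ 𝕜) -
        (Bᵀ * L * Cpᵀ + Dpᵀ) * (Cp * Q * B + Dp)) *ᵥ u = 0 := by
  rw [hasEigenvalue_toLin'_iff]
  constructor
  · rintro ⟨v, hv, h⟩
    rw [Matrix.fromBlocks_mulVec] at h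
    have e1 : s • (v ∘ Sum.inl) = _ := congrArg (· ∘ Sum.inl) h
    have e2 : s • (v ∘ Sum.inr) = _ := congrArg (· ∘ Sum.inr) h
    simp only [Sum.elim_comp_inl, Sum.elim_comp_inr] at e1 e2
    have st := (isStationaryPoint_iff_eigenvector hW hWt _ _ _).2 ⟨rfl, e1, e2⟩
    obtain ⟨hx, hl, hu⟩ := (isStationaryPoint_iff_popov hQ hL _ _ _).1 st
    -- The input is nonzero: `u = 0` would force `x = Q B u = 0`, then `l = 0`, and the eigenvector
    -- would vanish.
    refine ⟨_, fun h0 => hv ?_, hu⟩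
    rw [h0] at hx hl
    rw [Matrix.mulVec_zero, Matrix.mulVec_zero] at hx
    rw [hx] at hl
    simp only [Matrix.mulVec_zero, add_zero, smul_zero, sub_zero] at hl
    rw [← Sum.elim_comp_inl_inr v, hx, hl]
    exact Sum.elim_zero_zero
  · rintro ⟨u, hu0, hu⟩
    obtain ⟨x, l, st⟩ : ∃ x l, IsStationaryPoint A B Cp Dp Cr Dr γ ε s x l u :=
      ⟨_, _, (isStationaryPoint_iff_popov hQ hL _ _ u).2 ⟨rfl, rfl, hu⟩⟩
    obtain ⟨h1, h2, h3⟩ := (isStationaryPoint_iff_eigenvector hW hWt _ _ _).1 st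
    refine ⟨Sum.elim x l, fun h0 => hu0 ?_, ?_⟩
    · have a1 : x = 0 := congrArg (· ∘ Sum.inl) h0
      have a2 : l = 0 := congrArg (· ∘ Sum.inr) h0
      rw [h1, a1, a2]
      simp
    · rw [Matrix.fromBlocks_mulVec, Sum.elim_comp_inl, Sum.elim_comp_inr, ← h2, ← h3]
      ext (i | i) <;> rfl

end HamiltonianAlgebra

/-! ### Positivity of the Popov form, generalized singular values and a connectedness argument. -/

section Popov

variable {ι κ π ρ : Type*} [Fintype ι] [Fintype κ] [Fintype π] [Fintype ρ]

/-- The squared Euclidean norm of a complex vector. -/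
def sqNorm (w : ι → ℂ) : ℝ := ∑ i, ‖w i‖ ^ 2

lemma sqNorm_nonneg (w : ι → ℂ) : 0 ≤ sqNorm w := Finset.sum_nonneg fun _ _ => by positivity

@[simp] lemma sqNorm_zero : sqNorm (0 : ι → ℂ) = 0 := by simp [sqNorm]

lemma sqNorm_pos {w : ι → ℂ} (hw : w ≠ 0) : 0 < sqNorm w := by
  obtain ⟨i, hi⟩ := Function.ne_iff.1 hw
  exact Finset.sum_pos' (fun _ _ => by positivity) ⟨i, Finset.mem_univ _, by
    have : 0 < ‖w i‖ := norm_pos_iff.2 hi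
    positivity⟩

lemma sqNorm_smul (c : ℂ) (w : ι → ℂ) : sqNorm (c • w) = ‖c‖ ^ 2 * sqNorm w := by
  simp [sqNorm, mul_pow, Finset.mul_sum]

lemma continuous_sqNorm : Continuous (sqNorm : (ι → ℂ) → ℝ) := by
  unfold sqNorm; fun_prop

lemma star_dotProduct_self_eq (w : ι → ℂ) : star w ⬝ᵥ w = (sqNorm w : ℂ) := by
  simp only [dotProduct, sqNorm, Pi.star_apply, RCLike.star_def, Complex.conj_mul']
  push_cast; rfl

lemma star_dotProduct_conjTranspose_mul (G : Matrix π κ ℂ) (v : κ → ℂ) :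
    star v ⬝ᵥ (Gᴴ * G) *ᵥ v = (sqNorm (G *ᵥ v) : ℂ) := by
  rw [← star_dotProduct_self_eq, ← Matrix.mulVec_mulVec, Matrix.dotProduct_mulVec,
    Matrix.star_mulVec]

/-- The squared norm of `v` under `H` stacked on `√ε I`. -/
def regSqNorm (ε : ℝ) (H : Matrix ρ κ ℂ) (v : κ → ℂ) : ℝ := sqNorm (H *ᵥ v) + ε * sqNorm v

lemma regSqNorm_pos {ε : ℝ} (hε : 0 < ε) (H : Matrix ρ κ ℂ) {v : κ → ℂ} (hv : v ≠ 0) :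
    0 < regSqNorm ε H v :=
  add_pos_of_nonneg_of_pos (sqNorm_nonneg _) (mul_pos hε (sqNorm_pos hv))

lemma regSqNorm_smul (ε : ℝ) (H : Matrix ρ κ ℂ) (c : ℂ) (v : κ → ℂ) :
    regSqNorm ε H (c • v) = ‖c‖ ^ 2 * regSqNorm ε H v := by
  simp only [regSqNorm, Matrix.mulVec_smul, sqNorm_smul]; ring

lemma exists_smul_mem_sphere {v : κ → ℂ} (hv : v ≠ 0) :
    ∃ c : ℂ, c ≠ 0 ∧ c • v ∈ Metric.sphere (0 : κ → ℂ) 1 := by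
  have hn : ‖v‖ ≠ 0 := norm_ne_zero_iff.2 hv
  refine ⟨(‖v‖⁻¹ : ℝ), by simpa using hv, ?_⟩
  rw [mem_sphere_zero_iff_norm, norm_smul, Complex.norm_real, norm_inv, norm_norm,
    inv_mul_cancel₀ hn]

lemma Continuous.sqNorm_mulVec {α : Type*} [TopologicalSpace α] {f : α → Matrix π κ ℂ}
    {v : α → κ → ℂ} (hf : Continuous f) (hv : Continuous v) :
    Continuous fun a => sqNorm (f a *ᵥ v a) :=
  continuous_sqNorm.comp (hf.matrix_mulVec hv)

lemma Continuous.regSqNorm {α : Type*} [TopologicalSpace α] {f : α → Matrix ρ κ ℂ}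
    {v : α → κ → ℂ} (ε : ℝ) (hf : Continuous f) (hv : Continuous v) :
    Continuous fun a => regSqNorm ε (f a) (v a) :=
  (hf.sqNorm_mulVec hv).add ((continuous_sqNorm.comp hv).const_mul ε)

variable {Ω : Type*} [TopologicalSpace Ω] {Γ : Ω → Matrix π κ ℂ} {Θ : Ω → Matrix ρ κ ℂ}

/-- On a compact parameter space the largest generalized Rayleigh quotient is attained. -/
lemma exists_max_gain {ε : ℝ} [CompactSpace Ω] [Nonempty Ω] [Nonempty κ] (hε : 0 < ε)
    (hΓ : Continuous Γ) (hΘ : Continuous Θ) :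
    ∃ (ω₀ : Ω) (v₀ : κ → ℂ) (q : ℝ), v₀ ≠ 0 ∧ 0 ≤ q ∧
      sqNorm (Γ ω₀ *ᵥ v₀) = q * regSqNorm ε (Θ ω₀) v₀ ∧
      ∀ ω v, sqNorm (Γ ω *ᵥ v) ≤ q * regSqNorm ε (Θ ω) v := by
  have hne : ∀ v ∈ Metric.sphere (0 : κ → ℂ) 1, v ≠ 0 := fun v hv h => by simp [h] at hv
  have hpos : ∀ p ∈ (Set.univ : Set Ω) ×ˢ Metric.sphere (0 : κ → ℂ) 1,
      regSqNorm ε (Θ p.1) p.2 ≠ 0 := fun p hp => (regSqNorm_pos hε _ (hne _ hp.2)).ne'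
  have hf : ContinuousOn (fun p : Ω × (κ → ℂ) => sqNorm (Γ p.1 *ᵥ p.2) / regSqNorm ε (Θ p.1) p.2)
      (Set.univ ×ˢ Metric.sphere (0 : κ → ℂ) 1) :=
    ((hΓ.comp continuous_fst).sqNorm_mulVec continuous_snd).continuousOn.div
      ((hΘ.comp continuous_fst).regSqNorm ε continuous_snd).continuousOn hpos
  have hcomp : IsCompact ((Set.univ : Set Ω) ×ˢ Metric.sphere (0 : κ → ℂ) 1) :=
    isCompact_univ.prod (isCompact_sphere _ _)
  have hnonempty : ((Set.univ : Set Ω) ×ˢ Metric.sphere (0 : κ → ℂ) 1).Nonempty :=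
    Set.univ_nonempty.prod (NormedSpace.sphere_nonempty.2 zero_le_one)
  obtain ⟨⟨ω₀, v₀⟩, hmem, hmax⟩ := hcomp.exists_isMaxOn hnonempty hf
  have hv₀ := hne _ hmem.2
  have hr₀ := regSqNorm_pos hε (Θ ω₀) hv₀
  refine ⟨ω₀, v₀, sqNorm (Γ ω₀ *ᵥ v₀) / regSqNorm ε (Θ ω₀) v₀, hv₀,
    div_nonneg (sqNorm_nonneg _) hr₀.le, (div_mul_cancel₀ _ hr₀.ne').symm, fun ω v => ?_⟩
  by_cases hv : v = 0
  · simp [hv, regSqNorm]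
  -- The quotient is invariant under scaling, so its maximum over the unit sphere bounds it
  -- everywhere.
  obtain ⟨c, hc, hcv⟩ := exists_smul_mem_sphere hv
  have hc2 : 0 < ‖c‖ ^ 2 := by have := norm_pos_iff.2 hc; positivity
  have h1 : sqNorm (Γ ω *ᵥ (c • v)) / regSqNorm ε (Θ ω) (c • v) ≤
      sqNorm (Γ ω₀ *ᵥ v₀) / regSqNorm ε (Θ ω₀) v₀ :=
    isMaxOn_iff.1 hmax (ω, c • v) ⟨Set.mem_univ _, hcv⟩
  rw [Matrix.mulVec_smul, sqNorm_smul, regSqNorm_smul, mul_div_mul_left _ _ hc2.ne'] at h1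
  rwa [div_le_iff₀ (regSqNorm_pos hε _ hv)] at h1

variable [DecidableEq κ]

/-- The Popov matrix `g (Hᴴ H + ε I) - Gᴴ G`. -/
def popovMatrix (g ε : ℝ) (G : Matrix π κ ℂ) (H : Matrix ρ κ ℂ) : Matrix κ κ ℂ :=
  (g : ℂ) • (Hᴴ * H) + ((g : ℂ) * ε) • (1 : Matrix κ κ ℂ) - Gᴴ * G

variable {g ε : ℝ} {G : Matrix π κ ℂ} {H : Matrix ρ κ ℂ}

lemma star_dotProduct_popovMatrix (v : κ → ℂ) :
    star v ⬝ᵥ popovMatrix g ε G H *ᵥ v =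
      ((g * regSqNorm ε H v - sqNorm (G *ᵥ v) : ℝ) : ℂ) := by
  rw [popovMatrix, Matrix.sub_mulVec, Matrix.add_mulVec, Matrix.smul_mulVec, Matrix.smul_mulVec,
    Matrix.one_mulVec, dotProduct_sub, dotProduct_add, dotProduct_smul, dotProduct_smul,
    star_dotProduct_conjTranspose_mul, star_dotProduct_conjTranspose_mul, star_dotProduct_self_eq,
    regSqNorm]
  simp only [smul_eq_mul]
  push_cast; ring

lemma sqNorm_eq_of_popovMatrix_mulVec_eq_zero {v : κ → ℂ}
    (h : popovMatrix g ε G H *ᵥ v = 0) : sqNorm (G *ᵥ v) = g * regSqNorm ε H v := by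
  have := star_dotProduct_popovMatrix (g := g) (ε := ε) (G := G) (H := H) v
  rw [h, dotProduct_zero, eq_comm, Complex.ofReal_eq_zero] at this
  linarith

-- The inequality makes the Popov matrix positive semidefinite, and a vector at which a semidefinite
-- form vanishes lies in the kernel.
open scoped ComplexOrder in
lemma popovMatrix_mulVec_eq_zero_of_extremal
    (h : ∀ w, sqNorm (G *ᵥ w) ≤ g * regSqNorm ε H w) {v : κ → ℂ}
    (hv : sqNorm (G *ᵥ v) = g * regSqNorm ε H v) : popovMatrix g ε G H *ᵥ v = 0 := by
  have hpsd : (popovMatrix g ε G H).PosSemidef := by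
    rw [Matrix.posSemidef_iff_dotProduct_mulVec]
    refine ⟨by simp [Matrix.IsHermitian, popovMatrix], fun w => ?_⟩
    rw [star_dotProduct_popovMatrix]
    exact_mod_cast sub_nonneg.2 (h w)
  rw [← hpsd.dotProduct_mulVec_zero_iff, star_dotProduct_popovMatrix, hv, sub_self,
    Complex.ofReal_zero]

lemma conjTranspose_fromRows_mul_self (hε : 0 ≤ ε) :
    (Matrix.fromRows H ((Real.sqrt ε : ℂ) • (1 : Matrix κ κ ℂ)))ᴴ *
      Matrix.fromRows H ((Real.sqrt ε : ℂ) • (1 : Matrix κ κ ℂ)) =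
      Hᴴ * H + (ε : ℂ) • (1 : Matrix κ κ ℂ) := by
  rw [Matrix.conjTranspose_fromRows_eq_fromCols_conjTranspose, Matrix.fromCols_mul_fromRows]
  simp only [Matrix.conjTranspose_smul, Matrix.conjTranspose_one, RCLike.star_def,
    Complex.conj_ofReal, smul_mul_smul_comm, mul_one]
  rw [← Complex.ofReal_mul, Real.mul_self_sqrt hε]

/-- If all generalized singular values are below `√γ`, then the Popov form is positive. -/
lemma sqNorm_lt_of_genSingularValues {γ : ℝ} (hγ : 0 < γ) (hε : 0 < ε)
    (h : ∀ σ ∈ genSingularValues G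
      (Matrix.fromRows H ((Real.sqrt ε : ℂ) • (1 : Matrix κ κ ℂ))), σ ^ 2 < γ)
    {v : κ → ℂ} (hv : v ≠ 0) : sqNorm (G *ᵥ v) < γ * regSqNorm ε H v := by
  have : Nonempty κ := (Function.ne_iff.1 hv).nonempty
  obtain ⟨-, v₀, q, hv₀, hq, heq, hle⟩ := exists_max_gain (Ω := Unit) (Γ := fun _ => G)
    (Θ := fun _ => H) hε continuous_const continuous_const
  -- A maximizer of the quotient is a null vector of the Popov matrix for `q`, so `√q` is a
  -- generalized singular value. The case `q = 0` is separate because generalized singular values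
  -- are positive.
  have hqγ : q < γ := by
    rcases hq.eq_or_lt with rfl | hq
    · exact hγ
    have h0 := popovMatrix_mulVec_eq_zero_of_extremal (hle ()) heq
    rw [← Real.sq_sqrt hq.le]
    refine h _ ⟨Real.sqrt_pos.2 hq, v₀, hv₀, ?_⟩
    rw [conjTranspose_fromRows_mul_self hε.le, ← Complex.ofReal_pow, Real.sq_sqrt hq.le]
    rw [popovMatrix, Matrix.sub_mulVec, sub_eq_zero] at h0
    rw [← h0, ← Matrix.smul_mulVec, smul_add, smul_smul]
  exact (hle () v).trans_lt (mul_lt_mul_of_pos_right hqγ (regSqNorm_pos hε _ hv))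

/-- A continuous family of Popov matrices on a compact connected space that is nonsingular
everywhere and positive definite at one point is uniformly positive definite. -/
theorem exists_uniform_gain_lt [CompactSpace Ω] [PreconnectedSpace Ω] {γ : ℝ} (hγ : 0 < γ)
    (hε : 0 < ε) (hΓ : Continuous Γ) (hΘ : Continuous Θ)
    (hns : ∀ ω v, v ≠ 0 → popovMatrix γ ε (Γ ω) (Θ ω) *ᵥ v ≠ 0)
    (ω₁ : Ω) (h₁ : ∀ v, v ≠ 0 → sqNorm (Γ ω₁ *ᵥ v) < γ * regSqNorm ε (Θ ω₁) v) :
    ∃ g : ℝ, 0 ≤ g ∧ g < γ ∧ ∀ ω v, sqNorm (Γ ω *ᵥ v) ≤ g * regSqNorm ε (Θ ω) v := by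
  have : Nonempty Ω := ⟨ω₁⟩
  set S : Set Ω := {ω | ∀ v, v ≠ 0 → sqNorm (Γ ω *ᵥ v) < γ * regSqNorm ε (Θ ω) v} with hS
  -- Equality in the weak inequality would give a null vector, so nonsingularity makes the strict
  -- and the weak condition coincide.
  have hclosed : IsClosed S := by
    have hS' : S = ⋂ v, {ω | sqNorm (Γ ω *ᵥ v) ≤ γ * regSqNorm ε (Θ ω) v} := by
      ext ω
      simp only [hS, Set.mem_ofPred_eq, Set.mem_iInter]
      refine ⟨fun h v => ?_, fun h v hv => lt_of_le_of_ne (h v) fun heq =>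
        hns ω v hv (popovMatrix_mulVec_eq_zero_of_extremal h heq)⟩
      by_cases hv : v = 0
      · simp [hv, regSqNorm]
      · exact (h v hv).le
    rw [hS']
    exact isClosed_iInter fun v => isClosed_le (hΓ.sqNorm_mulVec continuous_const)
      ((hΘ.regSqNorm ε continuous_const).const_mul γ)
  -- The complement is the projection of a closed set along the compact unit sphere, hence closed.
  have hopen : IsOpen S := by
    have hS' : Sᶜ = Prod.snd '' {p : Metric.sphere (0 : κ → ℂ) 1 × Ω |
        γ * regSqNorm ε (Θ p.2) p.1 ≤ sqNorm (Γ p.2 *ᵥ (p.1 : κ → ℂ))} := by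
      ext ω
      simp only [hS, Set.mem_compl_iff, Set.mem_ofPred_eq, not_forall, not_lt, Set.mem_image,
        Prod.exists, exists_eq_right]
      constructor
      · rintro ⟨v, hv, h⟩
        obtain ⟨c, hc, hcv⟩ := exists_smul_mem_sphere hv
        refine ⟨⟨c • v, hcv⟩, ?_⟩
        simp only [Matrix.mulVec_smul, sqNorm_smul, regSqNorm_smul]
        have := mul_le_mul_of_nonneg_left h (sq_nonneg ‖c‖)
        linarith
      · rintro ⟨⟨v, hv⟩, h⟩
        exact ⟨v, fun h0 => by simp [h0] at hv, h⟩
    rw [← isClosed_compl_iff, hS']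
    have hval : Continuous fun p : Metric.sphere (0 : κ → ℂ) 1 × Ω => (p.1 : κ → ℂ) :=
      continuous_subtype_val.comp continuous_fst
    exact isClosedMap_snd_of_compactSpace _ (isClosed_le
      (((hΘ.comp continuous_snd).regSqNorm ε hval).const_mul γ)
      ((hΓ.comp continuous_snd).sqNorm_mulVec hval))
  have huniv : S = Set.univ := IsClopen.eq_univ ⟨hclosed, hopen⟩ ⟨ω₁, h₁⟩
  cases isEmpty_or_nonempty κ with
  | inl h =>
    refine ⟨0, le_rfl, hγ, fun ω v => ?_⟩
    simp [Subsingleton.elim v 0]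
  | inr h =>
    -- The supremum of the quotient is attained, so the pointwise strict inequality yields a uniform
    -- `q < γ`.
    obtain ⟨ω₀, v₀, q, hv₀, hq, heq, hle⟩ := exists_max_gain hε hΓ hΘ
    refine ⟨q, hq, ?_, hle⟩
    have h0 : ω₀ ∈ S := huniv ▸ Set.mem_univ _
    have := h0 v₀ hv₀
    rw [heq] at this
    exact lt_of_mul_lt_mul_right this (regSqNorm_pos hε _ hv₀).le

end Popov

/-! ### Continuity of the frequency response on the compactified frequency axis. -/

section FrequencyResponse

open scoped Matrix.Norms.Operator

variable {n m q : ℕ}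

lemma IsHurwitz.isUnit_sub {A : Matrix (Fin n) (Fin n) ℝ} (hA : IsHurwitz A) {s : ℂ}
    (hs : 0 ≤ s.re) : IsUnit (s • (1 : Matrix (Fin n) (Fin n) ℂ) - toComplexMatrix A) := by
  rw [← Algebra.algebraMap_eq_smul_one, ← spectrum.notMem_iff, ← Matrix.spectrum_toLin',
    ← Module.End.hasEigenvalue_iff_mem_spectrum]
  exact fun h => absurd (hA s h) (not_lt.2 hs)

/-- The frequency response `G(iω)`, with the value `D` at infinity. -/
def frequencyResponse (A : Matrix (Fin n) (Fin n) ℝ) (B : Matrix (Fin n) (Fin m) ℝ)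
    (C : Matrix (Fin q) (Fin n) ℝ) (D : Matrix (Fin q) (Fin m) ℝ) (ω : OnePoint ℝ) :
    Matrix (Fin q) (Fin m) ℂ :=
  ω.elim (toComplexMatrix D) fun ω : ℝ => transferFunction A B C D (Complex.I * ω)

/-- Stability keeps the imaginary axis in the resolvent set, and the resolvent vanishes at infinity,
leaving `D`. The one-point compactification supplies the compact connected space needed for the
uniform gain bound. -/
lemma continuous_frequencyResponse {A : Matrix (Fin n) (Fin n) ℝ} (hA : IsHurwitz A)
    (B : Matrix (Fin n) (Fin m) ℝ) (C : Matrix (Fin q) (Fin n) ℝ)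
    (D : Matrix (Fin q) (Fin m) ℝ) : Continuous (frequencyResponse A B C D) := by
  have hres : ∀ s : ℂ, (s • (1 : Matrix (Fin n) (Fin n) ℂ) - toComplexMatrix A)⁻¹ =
      resolvent (toComplexMatrix A) s := fun s => by
    rw [Matrix.nonsing_inv_eq_ringInverse, resolvent, Algebra.algebraMap_eq_smul_one]
  rw [OnePoint.continuous_iff]
  simp only [frequencyResponse, OnePoint.elim_infty, OnePoint.elim_some, transferFunction, hres]
  constructor
  · have h1 : Tendsto (fun ω : ℝ => Complex.I * ω) (coclosedCompact ℝ)
        (Bornology.cobounded ℂ) := by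
      rw [← tendsto_norm_atTop_iff_cobounded, coclosedCompact_eq_cocompact]
      simp_rw [norm_mul, Complex.norm_I, Complex.norm_real, one_mul]
      exact tendsto_norm_cocompact_atTop
    have h2 : Tendsto (fun ω : ℝ => resolvent (toComplexMatrix A) (Complex.I * ω))
        (coclosedCompact ℝ) (𝓝 0) :=
      (spectrum.resolvent_tendsto_cobounded (𝕜 := ℂ) (toComplexMatrix A)).comp h1
    have hc : Continuous fun M : Matrix (Fin n) (Fin n) ℂ =>
        toComplexMatrix C * M * toComplexMatrix B + toComplexMatrix D := by fun_prop
    simpa [Function.comp_def] using (hc.tendsto 0).comp h2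
  · have h2 : Continuous fun ω : ℝ => resolvent (toComplexMatrix A) (Complex.I * ω) := by
      refine continuous_iff_continuousAt.2 fun ω => ?_
      have hmem : Complex.I * ω ∈ resolventSet ℂ (toComplexMatrix A) := by
        rw [spectrum.mem_resolventSet_iff, Algebra.algebraMap_eq_smul_one]
        exact hA.isUnit_sub (by simp)
      exact ContinuousAt.comp (f := fun ω : ℝ => Complex.I * (ω : ℂ))
        (spectrum.hasDerivAt_resolvent_const_left hmem).continuousAt (by fun_prop)
    fun_prop

end FrequencyResponse

/-! ### Passage between real signals and complex vectors. -/

section Complexification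

variable {n m q : ℕ}

lemma conjTranspose_toComplexMatrix (M : Matrix (Fin q) (Fin n) ℝ) :
    (toComplexMatrix M)ᴴ = (toComplexMatrix M)ᵀ := by
  ext i j; simp

lemma toComplexMatrix_transpose (M : Matrix (Fin q) (Fin n) ℝ) :
    toComplexMatrix Mᵀ = (toComplexMatrix M)ᵀ := rfl

lemma toComplexMatrix_mul (M : Matrix (Fin q) (Fin n) ℝ) (N : Matrix (Fin n) (Fin m) ℝ) :
    toComplexMatrix (M * N) = toComplexMatrix M * toComplexMatrix N :=
  Matrix.map_mul (f := Complex.ofRealHom)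

lemma toComplexMatrix_smul (c : ℝ) (M : Matrix (Fin q) (Fin n) ℝ) :
    toComplexMatrix (c • M) = (c : ℂ) • toComplexMatrix M := by
  ext i j; simp

lemma toComplexMatrix_add (M N : Matrix (Fin q) (Fin n) ℝ) :
    toComplexMatrix (M + N) = toComplexMatrix M + toComplexMatrix N := by
  ext i j; simp

lemma toComplexMatrix_sub (M N : Matrix (Fin q) (Fin n) ℝ) :
    toComplexMatrix (M - N) = toComplexMatrix M - toComplexMatrix N := by
  ext i j; simp

lemma toComplexMatrix_neg (M : Matrix (Fin q) (Fin n) ℝ) :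
    toComplexMatrix (-M) = -toComplexMatrix M := by
  ext i j; simp

lemma toComplexMatrix_one : toComplexMatrix (1 : Matrix (Fin n) (Fin n) ℝ) = 1 :=
  Matrix.map_one _ Complex.ofReal_zero Complex.ofReal_one

/-- A real matrix as a continuous linear map between complex Euclidean spaces. -/
def complexCLM (M : Matrix (Fin q) (Fin n) ℝ) :
    EuclideanSpace ℂ (Fin n) →L[ℂ] EuclideanSpace ℂ (Fin q) :=
  (Matrix.toLpLin 2 2 (toComplexMatrix M)).toContinuousLinearMap

lemma ofLp_complexCLM (M : Matrix (Fin q) (Fin n) ℝ) (z : EuclideanSpace ℂ (Fin n)) :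
    (complexCLM M z).ofLp = toComplexMatrix M *ᵥ z.ofLp := rfl

lemma norm_sq_eq_sqNorm (z : EuclideanSpace ℂ (Fin n)) : ‖z‖ ^ 2 = sqNorm z.ofLp :=
  EuclideanSpace.norm_sq_eq z

lemma complexCLM_re_lt_zero {A : Matrix (Fin n) (Fin n) ℝ} (hA : IsHurwitz A) {μ : ℂ}
    (hμ : Module.End.HasEigenvalue
      (complexCLM A : EuclideanSpace ℂ (Fin n) →ₗ[ℂ] EuclideanSpace ℂ (Fin n)) μ) : μ.re < 0 := by
  obtain ⟨v, hv⟩ := hμ.exists_hasEigenvector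
  refine hA μ (hasEigenvalue_toLin'_iff.2 ⟨v.ofLp, fun h => hv.2 ?_, ?_⟩)
  · ext i; simp [h]
  · exact (congrArg WithLp.ofLp hv.apply_eq_smul).symm

lemma mem_resolventSet_complexCLM {A : Matrix (Fin n) (Fin n) ℝ} (hA : IsHurwitz A) (ω : ℝ) :
    Complex.I * ω ∈ resolventSet ℂ (complexCLM A) := by
  have h := (hA.isUnit_sub (s := Complex.I * ω) (by simp)).map
    (Matrix.toEuclideanCLM (n := Fin n) (𝕜 := ℂ))
  rw [map_sub, map_smul, map_one] at h
  rw [spectrum.mem_resolventSet_iff, Algebra.algebraMap_eq_smul_one]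
  exact h

lemma smul_eq_complexCLM_iff {A : Matrix (Fin n) (Fin n) ℝ} (hA : IsHurwitz A)
    {B : Matrix (Fin n) (Fin m) ℝ} {ω : ℝ} {z : EuclideanSpace ℂ (Fin n)}
    {w : EuclideanSpace ℂ (Fin m)} :
    (Complex.I * ω) • z = complexCLM A z + complexCLM B w ↔
      z.ofLp = ((Complex.I * ω) • (1 : Matrix (Fin n) (Fin n) ℂ) - toComplexMatrix A)⁻¹ *ᵥ
        (toComplexMatrix B *ᵥ w.ofLp) := by
  have hU := hA.isUnit_sub (s := Complex.I * ω) (by simp)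
  rw [Matrix.isUnit_iff_isUnit_det] at hU
  set T := (Complex.I * ω) • (1 : Matrix (Fin n) (Fin n) ℂ) - toComplexMatrix A with hT
  have e : (Complex.I * ω) • z = complexCLM A z + complexCLM B w ↔
      T *ᵥ z.ofLp = toComplexMatrix B *ᵥ w.ofLp := by
    rw [hT, Matrix.sub_mulVec, Matrix.smul_mulVec, Matrix.one_mulVec, sub_eq_iff_eq_add']
    exact (WithLp.ofLp_injective 2).eq_iff.symm
  rw [e]
  constructor
  · intro h
    rw [← h, Matrix.mulVec_mulVec, Matrix.nonsing_inv_mul _ hU, Matrix.one_mulVec]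
  · intro h
    rw [h, Matrix.mulVec_mulVec, Matrix.mul_nonsing_inv _ hU, Matrix.one_mulVec]

lemma norm_sq_output_eq {A : Matrix (Fin n) (Fin n) ℝ} (hA : IsHurwitz A)
    {B : Matrix (Fin n) (Fin m) ℝ} {ω : ℝ} {z : EuclideanSpace ℂ (Fin n)}
    {w : EuclideanSpace ℂ (Fin m)}
    (h : (Complex.I * ω) • z = complexCLM A z + complexCLM B w)
    (C : Matrix (Fin q) (Fin n) ℝ) (D : Matrix (Fin q) (Fin m) ℝ) :
    ‖complexCLM C z + complexCLM D w‖ ^ 2 =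
      sqNorm (transferFunction A B C D (Complex.I * ω) *ᵥ w.ofLp) := by
  rw [norm_sq_eq_sqNorm, WithLp.ofLp_add, ofLp_complexCLM, ofLp_complexCLM,
    (smul_eq_complexCLM_iff hA).1 h, transferFunction, Matrix.add_mulVec,
    ← Matrix.mulVec_mulVec, ← Matrix.mulVec_mulVec]

/-- Entrywise inclusion of real vectors into complex vectors. -/
def ofRealVec (n : ℕ) : EuclideanSpace ℝ (Fin n) →L[ℝ] EuclideanSpace ℂ (Fin n) :=
  LinearMap.toContinuousLinearMap
    { toFun := fun x => WithLp.toLp 2 fun i => (x i : ℂ)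
      map_add' := fun x y => by ext i; simp
      map_smul' := fun c x => by ext i; simp }

/-- The entrywise real part. -/
def reVec (n : ℕ) : EuclideanSpace ℂ (Fin n) →L[ℝ] EuclideanSpace ℝ (Fin n) :=
  LinearMap.toContinuousLinearMap
    { toFun := fun z => WithLp.toLp 2 fun i => (z i).re
      map_add' := fun x y => by ext i; simp
      map_smul' := fun c x => by ext i; simp }

/-- The entrywise imaginary part. -/
def imVec (n : ℕ) : EuclideanSpace ℂ (Fin n) →L[ℝ] EuclideanSpace ℝ (Fin n) :=
  LinearMap.toContinuousLinearMap
    { toFun := fun z => WithLp.toLp 2 fun i => (z i).im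
      map_add' := fun x y => by ext i; simp
      map_smul' := fun c x => by ext i; simp }

@[simp] lemma ofRealVec_apply (x : EuclideanSpace ℝ (Fin n)) (i : Fin n) :
    ofRealVec n x i = (x i : ℂ) := rfl

@[simp] lemma reVec_apply (z : EuclideanSpace ℂ (Fin n)) (i : Fin n) :
    reVec n z i = (z i).re := rfl

@[simp] lemma imVec_apply (z : EuclideanSpace ℂ (Fin n)) (i : Fin n) :
    imVec n z i = (z i).im := rfl

lemma enorm_ofRealVec (x : EuclideanSpace ℝ (Fin n)) : ‖ofRealVec n x‖ₑ = ‖x‖ₑ := by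
  rw [← ofReal_norm, ← ofReal_norm]
  simp [EuclideanSpace.norm_eq]

lemma enorm_sq_eq_re_add_im (z : EuclideanSpace ℂ (Fin n)) :
    ‖z‖ₑ ^ 2 = ‖reVec n z‖ₑ ^ 2 + ‖imVec n z‖ₑ ^ 2 := by
  simp_rw [← ofReal_norm, ← ENNReal.ofReal_pow (norm_nonneg _)]
  rw [← ENNReal.ofReal_add (by positivity) (by positivity)]
  simp only [EuclideanSpace.norm_sq_eq, reVec_apply, imVec_apply, ← Finset.sum_add_distrib]
  congr 2; ext i
  rw [Complex.sq_norm, Complex.normSq_apply, Real.norm_eq_abs, Real.norm_eq_abs, sq_abs, sq_abs]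
  ring

lemma ofRealVec_outputSignal (C : Matrix (Fin q) (Fin n) ℝ) (D : Matrix (Fin q) (Fin m) ℝ)
    (x : ℝ → EuclideanSpace ℝ (Fin n)) (u : ℝ → EuclideanSpace ℝ (Fin m)) (t : ℝ) :
    ofRealVec q (outputSignal C D x u t) =
      complexCLM C (ofRealVec n (x t)) + complexCLM D (ofRealVec m (u t)) := by
  ext i
  simp [outputSignal, ofLp_complexCLM, Matrix.mulVec, dotProduct]

lemma reVec_output (C : Matrix (Fin q) (Fin n) ℝ) (D : Matrix (Fin q) (Fin m) ℝ)
    (x : ℝ → EuclideanSpace ℂ (Fin n)) (u : ℝ → EuclideanSpace ℂ (Fin m)) (t : ℝ) :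
    reVec q (complexCLM C (x t) + complexCLM D (u t)) =
      outputSignal C D (fun t => reVec n (x t)) (fun t => reVec m (u t)) t := by
  ext i
  simp [outputSignal, ofLp_complexCLM, Matrix.mulVec, dotProduct]

lemma imVec_output (C : Matrix (Fin q) (Fin n) ℝ) (D : Matrix (Fin q) (Fin m) ℝ)
    (x : ℝ → EuclideanSpace ℂ (Fin n)) (u : ℝ → EuclideanSpace ℂ (Fin m)) (t : ℝ) :
    imVec q (complexCLM C (x t) + complexCLM D (u t)) =
      outputSignal C D (fun t => imVec n (x t)) (fun t => imVec m (u t)) t := by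
  ext i
  simp [outputSignal, ofLp_complexCLM, Matrix.mulVec, dotProduct]

lemma lintegral_eq_energy_add_energy {y : ℝ → EuclideanSpace ℂ (Fin n)} (hy : Continuous y) :
    ∫⁻ t in Set.Ici 0, ‖y t‖ₑ ^ 2 =
      energy (fun t => reVec n (y t)) + energy (fun t => imVec n (y t)) := by
  simp_rw [enorm_sq_eq_re_add_im]
  exact lintegral_add_left (((reVec n).continuous.comp hy).enorm.measurable.pow_const 2) _

end Complexification

/-! ### The gain, the frequency domain inequality and the Hamiltonian test. -/

namespace TwoOutputSystem

variable {n m p r : ℕ} {S : TwoOutputSystem n m p r} {ε γ : ℝ}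

lemma outputSignal_smul {q : ℕ} (C : Matrix (Fin q) (Fin n) ℝ) (D : Matrix (Fin q) (Fin m) ℝ)
    (x : ℝ → EuclideanSpace ℝ (Fin n)) (u : ℝ → EuclideanSpace ℝ (Fin m)) (c : ℝ) :
    outputSignal C D (c • x) (c • u) = c • outputSignal C D x u := by
  ext t i
  simp [outputSignal, Matrix.mulVec_smul]

lemma energy_smul {q : ℕ} (c : ℝ) (y : ℝ → EuclideanSpace ℝ (Fin q)) :
    energy (c • y) = ENNReal.ofReal (c ^ 2) * energy y := by
  have h : ENNReal.ofReal (c ^ 2) = ‖c‖ₑ ^ 2 := by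
    rw [← ofReal_norm, ← ENNReal.ofReal_pow (norm_nonneg _), Real.norm_eq_abs, sq_abs]
  simp only [energy, Pi.smul_apply, enorm_smul, mul_pow]
  rw [lintegral_const_mul' _ _ (by simp), h]

/-- A bound on the gain yields the energy inequality for every trajectory tending to zero. -/
lemma energy_le_of_rcoog_le {g : ℝ} (hg : 0 < g) (hS : S.rcoog ε ≤ ENNReal.ofReal g)
    {u : ℝ → EuclideanSpace ℝ (Fin m)} {x : ℝ → EuclideanSpace ℝ (Fin n)} (hu : MemL2e u)
    (hx : S.IsTrajectoryFromZero u x) (hlim : Tendsto x atTop (𝓝 0)) :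
    energy (outputSignal S.Cp S.Dp x u) ≤ ENNReal.ofReal g *
      (energy (outputSignal S.Cr S.Dr x u) + ENNReal.ofReal ε * energy u) := by
  set E := energy (outputSignal S.Cr S.Dr x u) + ENNReal.ofReal ε * energy u with hE
  have hg0 : ENNReal.ofReal g ≠ 0 := by simpa using hg
  rw [← ENNReal.div_le_iff' hg0 ENNReal.ofReal_ne_top]
  by_contra! hlt
  -- Scaling by `1/√e` with `e` strictly between the constraint energy and the performance energy
  -- divided by `g` gives a feasible pair whose performance exceeds `g`. Using `e` in place of the
  -- constraint energy itself covers a vanishing constraint and an infinite performance.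
  obtain ⟨e, he1, he2⟩ := ENNReal.lt_iff_exists_nnreal_btwn.1 hlt
  have he0 : 0 < (e : ℝ) := by
    have : (0 : ℝ≥0∞) < e := pos_of_gt he1
    exact_mod_cast this
  set c : ℝ := (Real.sqrt e)⁻¹ with hc
  have hc2 : ENNReal.ofReal (c ^ 2) = (e : ℝ≥0∞)⁻¹ := by
    rw [hc, inv_pow, Real.sq_sqrt he0.le, ENNReal.ofReal_inv_of_pos he0,
      ENNReal.ofReal_coe_nnreal]
  have he : (e : ℝ≥0∞) ≠ 0 := by
    have : e ≠ 0 := by rintro rfl; simp at he0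
    exact_mod_cast this
  have hfeas : S.IsFeasible ε (c • u) (c • x) := by
    refine ⟨fun T => (hu T).const_smul c, ⟨hx.1.const_smul c, fun t ht => ?_⟩, ?_, ?_⟩
    · rw [outputSignal_smul, Pi.smul_apply, hx.2 t ht]
      exact (intervalIntegral.integral_smul c _).symm
    · rw [← smul_zero c]
      exact hlim.const_smul c
    · rw [outputSignal_smul, energy_smul, energy_smul, mul_left_comm, ← mul_add, ← hE, hc2,
        ENNReal.inv_mul_le_iff he ENNReal.coe_ne_top, mul_one]
      exact he1.le
  have hle : energy (outputSignal S.Cp S.Dp (c • x) (c • u)) ≤ S.rcoog ε :=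
    le_iSup_of_le (c • u) (le_iSup_of_le (c • x) (le_iSup_of_le hfeas le_rfl))
  rw [outputSignal_smul, energy_smul, hc2] at hle
  have := hle.trans hS
  rw [ENNReal.inv_mul_le_iff he ENNReal.coe_ne_top] at this
  refine absurd he2 (not_lt.2 ?_)
  rw [ENNReal.div_le_iff' hg0 ENNReal.ofReal_ne_top, mul_comm]
  exact this

/-- A bound on the gain yields the energy inequality for smooth complex trajectories. -/
lemma complex_energy_le_of_rcoog_le {g : ℝ} (hg : 0 < g) (hS : S.rcoog ε ≤ ENNReal.ofReal g)
    {u : ℝ → EuclideanSpace ℂ (Fin m)} {x : ℝ → EuclideanSpace ℂ (Fin n)} (hu : Continuous u)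
    (hx : Continuous x)
    (hd : ∀ t, HasDerivAt x (complexCLM S.A (x t) + complexCLM S.B (u t)) t) (h0 : x 0 = 0)
    (hlim : Tendsto x atTop (𝓝 0)) :
    ∫⁻ t in Set.Ici 0, ‖complexCLM S.Cp (x t) + complexCLM S.Dp (u t)‖ₑ ^ 2 ≤
      ENNReal.ofReal g *
        ((∫⁻ t in Set.Ici 0, ‖complexCLM S.Cr (x t) + complexCLM S.Dr (u t)‖ₑ ^ 2) +
          ENNReal.ofReal ε * ∫⁻ t in Set.Ici 0, ‖u t‖ₑ ^ 2) := by
  have hmem : ∀ {v : ℝ → EuclideanSpace ℝ (Fin m)}, Continuous v → MemL2e v := fun hv T => by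
    obtain ⟨M, hM⟩ := isCompact_Icc.exists_bound_of_continuousOn (hv.continuousOn (s := Set.Icc 0 T))
    exact MemLp.of_bound hv.aestronglyMeasurable M
      ((ae_restrict_mem measurableSet_Icc).mono hM)
  have hout : ∀ {q : ℕ} (C : Matrix (Fin q) (Fin n) ℝ) (D : Matrix (Fin q) (Fin m) ℝ),
      Continuous fun t => complexCLM C (x t) + complexCLM D (u t) := fun C D =>
    ((complexCLM C).continuous.comp hx).add ((complexCLM D).continuous.comp hu)
  have htraj : ∀ (L : ∀ k, EuclideanSpace ℂ (Fin k) →L[ℝ] EuclideanSpace ℝ (Fin k)),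
      (∀ t, L n (complexCLM S.A (x t) + complexCLM S.B (u t)) =
        outputSignal S.A S.B (fun t => L n (x t)) (fun t => L m (u t)) t) →
      S.IsTrajectoryFromZero (fun t => L m (u t)) (fun t => L n (x t)) ∧
        Tendsto (fun t => L n (x t)) atTop (𝓝 0) := by
    intro L hL
    refine ⟨⟨((L n).continuous.comp hx).continuousOn, fun t _ => ?_⟩, ?_⟩
    · have hder : ∀ τ, HasDerivAt (fun t => L n (x t))
          (outputSignal S.A S.B (fun t => L n (x t)) (fun t => L m (u t)) τ) τ := fun τ => by
        rw [← hL]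
        exact (L n).hasFDerivAt.comp_hasDerivAt τ (hd τ)
      have hcont : Continuous
          (outputSignal S.A S.B (fun t => L n (x t)) (fun t => L m (u t))) := by
        rw [← funext hL]
        exact (L n).continuous.comp (hout _ _)
      rw [intervalIntegral.integral_eq_sub_of_hasDerivAt (fun τ _ => hder τ)
        (hcont.intervalIntegrable _ _), h0, map_zero, sub_zero]
    · simpa [Function.comp_def] using ((L n).continuous.tendsto 0).comp hlim
  -- As the matrices are real, the real and imaginary parts are themselves trajectories, and their
  -- energies add up to the complex one.
  have hre := htraj reVec (reVec_output S.A S.B x u)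
  have him := htraj imVec (imVec_output S.A S.B x u)
  have b1 := energy_le_of_rcoog_le hg hS (hmem ((reVec m).continuous.comp hu)) hre.1 hre.2
  have b2 := energy_le_of_rcoog_le hg hS (hmem ((imVec m).continuous.comp hu)) him.1 him.2
  rw [lintegral_eq_energy_add_energy (hout S.Cp S.Dp),
    lintegral_eq_energy_add_energy (hout S.Cr S.Dr), lintegral_eq_energy_add_energy hu]
  simp_rw [reVec_output, imVec_output]
  refine (add_le_add b1 b2).trans (le_of_eq ?_)
  simp only [Function.comp_def]
  ring

lemma toComplexMatrix_calD (S : TwoOutputSystem n m p r) (ε γ : ℝ) :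
    toComplexMatrix (S.calD ε γ) =
      (γ : ℂ) • ((toComplexMatrix S.Dr)ᵀ * toComplexMatrix S.Dr) +
        ((γ : ℂ) * ε) • (1 : Matrix (Fin m) (Fin m) ℂ) -
        (toComplexMatrix S.Dp)ᵀ * toComplexMatrix S.Dp := by
  simp only [calD, toComplexMatrix_sub, toComplexMatrix_add, toComplexMatrix_smul,
    toComplexMatrix_mul, toComplexMatrix_one, toComplexMatrix_transpose, Complex.ofReal_mul]

lemma popovMatrix_calD (S : TwoOutputSystem n m p r) (ε γ : ℝ) :
    popovMatrix γ ε (toComplexMatrix S.Dp) (toComplexMatrix S.Dr) =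
      toComplexMatrix (S.calD ε γ) := by
  rw [toComplexMatrix_calD, popovMatrix, conjTranspose_toComplexMatrix,
    conjTranspose_toComplexMatrix]

/-- The Hamiltonian matrix has an imaginary eigenvalue if and only if the Popov matrix is singular
at some frequency. -/
lemma hasImaginaryEigenvalue_hamiltonian_iff (hA : IsHurwitz S.A) (hD : IsUnit (S.calD ε γ)) :
    HasImaginaryEigenvalue (S.hamiltonian ε γ) ↔
      ∃ (ω : ℝ) (v : Fin m → ℂ), v ≠ 0 ∧
        popovMatrix γ ε (S.Gp (Complex.I * ω)) (S.Gr (Complex.I * ω)) *ᵥ v = 0 := by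
  refine exists_congr fun ω => ?_
  have hU := hA.isUnit_sub (s := Complex.I * ω) (by simp)
  rw [Matrix.isUnit_iff_isUnit_det] at hU
  have hQ := Matrix.mul_nonsing_inv _ hU
  set Q := ((Complex.I * ω) • (1 : Matrix (Fin n) (Fin n) ℂ) - toComplexMatrix S.A)⁻¹ with hQdef
  -- On the imaginary axis `-s` is the conjugate of `s` and `A` is real, so the costate resolvent is
  -- `Qᴴ`. This turns the Popov function into the Hermitian matrix built from `G_pᴴ G_p` and `G_rᴴ
  -- G_r`.
  have hL : (-(Complex.I * ω) • (1 : Matrix (Fin n) (Fin n) ℂ) - (toComplexMatrix S.A)ᵀ) * Qᴴ =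
      1 := by
    have h := congrArg Matrix.conjTranspose (mul_eq_one_comm.1 hQ)
    rw [Matrix.conjTranspose_mul, Matrix.conjTranspose_sub, Matrix.conjTranspose_smul,
      Matrix.conjTranspose_one, conjTranspose_toComplexMatrix] at h
    simpa using h
  have hdet : IsUnit (S.calD ε γ).det := (Matrix.isUnit_iff_isUnit_det _).1 hD
  have hWt : (toComplexMatrix (S.calD ε γ)⁻¹)ᵀ = toComplexMatrix (S.calD ε γ)⁻¹ := by
    have hsymm : (S.calD ε γ)ᵀ = S.calD ε γ := by simp [calD]
    rw [← toComplexMatrix_transpose, Matrix.transpose_nonsing_inv, hsymm]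
  have hW : ((γ : ℂ) • ((toComplexMatrix S.Dr)ᵀ * toComplexMatrix S.Dr) +
      ((γ : ℂ) * ε) • (1 : Matrix (Fin m) (Fin m) ℂ) -
      (toComplexMatrix S.Dp)ᵀ * toComplexMatrix S.Dp) * toComplexMatrix (S.calD ε γ)⁻¹ = 1 := by
    rw [← toComplexMatrix_calD, ← toComplexMatrix_mul, Matrix.mul_nonsing_inv _ hdet,
      toComplexMatrix_one]
  have key := hasEigenvalue_hamiltonian_iff (B := toComplexMatrix S.B)
    (Cp := toComplexMatrix S.Cp) (Cr := toComplexMatrix S.Cr) hW hWt hQ hL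
  have hH : toComplexMatrix (S.hamiltonian ε γ) = Matrix.fromBlocks _ _ _ _ :=
    Matrix.fromBlocks_map _ _ _ _ _
  have hG : ∀ {q : ℕ} (C : Matrix (Fin q) (Fin n) ℝ) (D : Matrix (Fin q) (Fin m) ℝ),
      (transferFunction S.A S.B C D (Complex.I * ω))ᴴ =
        (toComplexMatrix S.B)ᵀ * Qᴴ * (toComplexMatrix C)ᵀ + (toComplexMatrix D)ᵀ := fun C D => by
    rw [transferFunction, Matrix.conjTranspose_add, Matrix.conjTranspose_mul,
      Matrix.conjTranspose_mul, conjTranspose_toComplexMatrix, conjTranspose_toComplexMatrix,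
      conjTranspose_toComplexMatrix, Matrix.mul_assoc]
  rw [hH]
  simp only [gainK, toComplexMatrix_sub, toComplexMatrix_add, toComplexMatrix_smul,
    toComplexMatrix_mul, toComplexMatrix_neg, toComplexMatrix_transpose]
  rw [popovMatrix, Gp, Gr, hG, hG]
  exact key

lemma isUnit_toComplexMatrix {M : Matrix (Fin m) (Fin m) ℝ} (hM : IsUnit M) :
    IsUnit (toComplexMatrix M) :=
  hM.map (Complex.ofRealHom.mapMatrix (m := Fin m))

/-- A uniform frequency domain bound yields a bound on the gain. -/
lemma rcoog_le_of_frequency (hA : IsHurwitz S.A) (hε : 0 < ε) {g : ℝ} (hg : 0 ≤ g)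
    (h : ∀ (ω : ℝ) (v : Fin m → ℂ), sqNorm (S.Gp (Complex.I * ω) *ᵥ v) ≤
      g * regSqNorm ε (S.Gr (Complex.I * ω)) v) :
    S.rcoog ε ≤ ENNReal.ofReal g := by
  obtain ⟨C, a, -, ha, hdecay⟩ := exists_norm_expFlow_le (complexCLM S.A)
    fun μ hμ => complexCLM_re_lt_zero hA hμ
  refine iSup_le fun u => iSup_le fun x => iSup_le fun hux => ?_
  obtain ⟨hu, ⟨hxc, hx⟩, hlim, hle⟩ := hux
  have hfreq : ∀ (ω : ℝ) (z : EuclideanSpace ℂ (Fin n)) (w : EuclideanSpace ℂ (Fin m)),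
      (Complex.I * ω) • z = complexCLM S.A z + complexCLM S.B w →
      ‖complexCLM S.Cp z + complexCLM S.Dp w‖ₑ ^ 2 ≤ ENNReal.ofReal g *
        (‖complexCLM S.Cr z + complexCLM S.Dr w‖ₑ ^ 2 + ENNReal.ofReal ε * ‖w‖ₑ ^ 2) := by
    intro ω z w hz
    simp_rw [← ofReal_norm, ← ENNReal.ofReal_pow (norm_nonneg _)]
    rw [← ENNReal.ofReal_mul hε.le, ← ENNReal.ofReal_add (by positivity) (by positivity),
      ← ENNReal.ofReal_mul hg, norm_sq_output_eq hA hz, norm_sq_output_eq hA hz, norm_sq_eq_sqNorm]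
    exact ENNReal.ofReal_le_ofReal (h ω w.ofLp)
  have hint : ∀ t, 0 ≤ t → ofRealVec n (x t) = ∫ τ in (0 : ℝ)..t,
      (complexCLM S.A (ofRealVec n (x τ)) + complexCLM S.B (ofRealVec m (u τ))) := by
    intro t ht
    have hi : IntervalIntegrable (outputSignal S.A S.B x u) volume 0 t := by
      rw [intervalIntegrable_iff_integrableOn_Ioc_of_le ht]
      have h1 : IntegrableOn x (Set.Icc 0 t) :=
        (hxc.mono Set.Icc_subset_Ici_self).integrableOn_compact isCompact_Icc
      have h2 : IntegrableOn u (Set.Icc 0 t) := (hu t).integrable (by norm_num)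
      have h3 := ((Matrix.toLpLin 2 2 S.A).toContinuousLinearMap.integrable_comp h1).add
        ((Matrix.toLpLin 2 2 S.B).toContinuousLinearMap.integrable_comp h2)
      exact IntegrableOn.mono_set h3 Set.Ioc_subset_Icc_self
    rw [hx t ht, ← (ofRealVec n).intervalIntegral_comp_comm hi]
    simp_rw [ofRealVec_outputSignal]
  have key := lintegral_output_le_of_frequency (u := fun t => ofRealVec m (u t))
    (x := fun t => ofRealVec n (x t)) ha hdecay ENNReal.ofReal_ne_top hfreq
    (fun T => (ofRealVec m).comp_memLp' (hu T)) ((ofRealVec n).continuous.comp_continuousOn hxc)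
    hint (by simpa [Function.comp_def] using ((ofRealVec n).continuous.tendsto 0).comp hlim)
  simp_rw [← ofRealVec_outputSignal, enorm_ofRealVec] at key
  calc _ ≤ _ := key
    _ ≤ ENNReal.ofReal g * 1 := by gcongr; exact hle
    _ = _ := mul_one _

/-- A bound on the gain yields a frequency domain bound. -/
lemma frequency_of_rcoog_le (hA : IsHurwitz S.A) (hε : 0 < ε) {g : ℝ} (hg : 0 < g)
    (hS : S.rcoog ε ≤ ENNReal.ofReal g) (ω : ℝ) (v : Fin m → ℂ) :
    sqNorm (S.Gp (Complex.I * ω) *ᵥ v) ≤ g * regSqNorm ε (S.Gr (Complex.I * ω)) v := by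
  obtain ⟨C, a, -, ha, hdecay⟩ := exists_norm_expFlow_le (complexCLM S.A)
    fun μ hμ => complexCLM_re_lt_zero hA hμ
  have hz := (smul_eq_complexCLM_iff hA (B := S.B) (ω := ω) (w := WithLp.toLp 2 v)
    (z := WithLp.toLp 2 _)).2 rfl
  have key := frequency_of_energy (Cp := complexCLM S.Cp) (Dp := complexCLM S.Dp)
    (Cr := complexCLM S.Cr) (Dr := complexCLM S.Dr) ha hdecay hg.le hε.le
    (fun u x hu hx hd h0 hl => complex_energy_le_of_rcoog_le hg hS hu hx hd h0 hl)
    (mem_resolventSet_complexCLM hA ω) hz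
  rwa [norm_sq_output_eq hA hz, norm_sq_output_eq hA hz, norm_sq_eq_sqNorm] at key

/-- A null vector `v` of the Popov matrix satisfies the frequency inequality with equality for `γ`;
this contradicts the inequality for any `g < γ`, since the regularized norm of `v` is positive. -/
lemma not_hasImaginaryEigenvalue_of_rcoog_lt (hA : IsHurwitz S.A) (hε : 0 < ε) (hγ : 0 < γ)
    (hD : IsUnit (S.calD ε γ)) (hS : S.rcoog ε < ENNReal.ofReal γ) :
    ¬ HasImaginaryEigenvalue (S.hamiltonian ε γ) := by
  rw [hasImaginaryEigenvalue_hamiltonian_iff hA hD]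
  rintro ⟨ω, v, hv, h⟩
  obtain ⟨g, hg, hSg, hgγ⟩ : ∃ g : ℝ, 0 < g ∧ S.rcoog ε ≤ ENNReal.ofReal g ∧ g < γ := by
    -- The maximum with `γ / 2` keeps `g` positive when the gain is zero.
    refine ⟨max (S.rcoog ε).toReal (γ / 2), lt_max_of_lt_right (by positivity), ?_,
      max_lt ?_ (by linarith)⟩
    · rw [← ENNReal.ofReal_toReal hS.ne_top]
      exact ENNReal.ofReal_le_ofReal (by rw [ENNReal.ofReal_toReal hS.ne_top]; exact le_max_left _ _)
    · rwa [← ENNReal.ofReal_lt_ofReal_iff hγ, ENNReal.ofReal_toReal hS.ne_top]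
  have h1 := frequency_of_rcoog_le hA hε hg hSg ω v
  rw [sqNorm_eq_of_popovMatrix_mulVec_eq_zero h] at h1
  exact absurd (le_of_mul_le_mul_right h1 (regSqNorm_pos hε _ hv)) (not_le.2 hgγ)

/-- Absence of imaginary eigenvalues gives nonsingularity at finite frequencies, invertibility of
`𝒟` gives it at infinity, and the generalized singular values give positivity at `ω₀`. -/
lemma rcoog_lt_of_not_hasImaginaryEigenvalue (hA : IsHurwitz S.A) (hε : 0 < ε) (hγ : 0 < γ)
    (hD : IsUnit (S.calD ε γ)) {ω₀ : ℝ}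
    (h₀ : ∀ σ ∈ genSingularValues (S.Gp (Complex.I * ω₀)) (S.GrReg ε (Complex.I * ω₀)), σ ^ 2 < γ)
    (hM : ¬ HasImaginaryEigenvalue (S.hamiltonian ε γ)) : S.rcoog ε < ENNReal.ofReal γ := by
  rw [hasImaginaryEigenvalue_hamiltonian_iff hA hD] at hM
  push Not at hM
  obtain ⟨g, hg, hgγ, h⟩ := exists_uniform_gain_lt hγ hε
    (continuous_frequencyResponse hA S.B S.Cp S.Dp) (continuous_frequencyResponse hA S.B S.Cr S.Dr)
    (fun ω v hv => by
      induction ω using OnePoint.rec with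
      | infty =>
        simp only [frequencyResponse, OnePoint.elim_infty]
        rw [popovMatrix_calD]
        intro h
        have hu := (Matrix.isUnit_iff_isUnit_det _).1 (isUnit_toComplexMatrix hD)
        exact hu.ne_zero (Matrix.exists_mulVec_eq_zero_iff.1 ⟨v, hv, h⟩)
      | coe ω => exact hM ω v hv)
    (ω₀ : OnePoint ℝ) (fun v hv => sqNorm_lt_of_genSingularValues hγ hε h₀ hv)
  exact (rcoog_le_of_frequency hA hε hg fun ω v => h ω v).trans_lt
    ((ENNReal.ofReal_lt_ofReal_iff hγ).2 hgγ)

end TwoOutputSystem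

end

theorem corollary1 {n m p r : ℕ} (S : TwoOutputSystem n m p r) (ε γ : ℝ)
    (hε : 0 < ε) (hγ : 0 < γ)
    (hA : IsHurwitz S.A)
    (hD : IsUnit (S.calD ε γ)) :
    (S.rcoog ε < ENNReal.ofReal γ → ¬ HasImaginaryEigenvalue (S.hamiltonian ε γ)) ∧
    ((∃ ω₀ : ℝ, ∀ σ ∈ genSingularValues (S.Gp (Complex.I * ω₀)) (S.GrReg ε (Complex.I * ω₀)),
        σ ^ 2 < γ) →
      (S.rcoog ε < ENNReal.ofReal γ ↔ ¬ HasImaginaryEigenvalue (S.hamiltonian ε γ))) := by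
  refine ⟨TwoOutputSystem.not_hasImaginaryEigenvalue_of_rcoog_lt hA hε hγ hD, fun ⟨ω₀, h₀⟩ =>
    ⟨TwoOutputSystem.not_hasImaginaryEigenvalue_of_rcoog_lt hA hε hγ hD,
      TwoOutputSystem.rcoog_lt_of_not_hasImaginaryEigenvalue hA hε hγ hD h₀⟩⟩
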